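/- Write $\mathbb{N}=\{1,2,3,\dots\}$. A Følner sequence is a sequence $\Phi=(\Phi_N)$ of finite non-empty subsets of $\mathbb{N}$ with $|(\Phi_N+m)\triangle\Phi_N|/|\Phi_N|\to 0$ for every $m\in\mathbb{N}$. For $f,h:\mathbb{N}\to\mathbb{C}$ put $$\|f\|_\Phi=\Big(\limsup_{N\to\infty}\frac1{|\Phi_N|}\sum_{n\in\Phi_N}|f(n)|^2\Big)^{1/2}\in[0,\infty],\qquad \langle f,h\rangle_\Phi=\lim_{N\to\infty}\frac1{|\Phi_N|}\sum_{n\in\Phi_N}f(n)\overline{h(n)}$$ (the latter whenever the limit exists), $L^2(\mathbb{N},\Phi)=\{f:\mathbb{N}\to\mathbb{C}\,:\,\|f\|_\Phi<\infty\}$, $(R^mf)(n)=f(n+m)$, and $\overline{d}_\Phi(A)=\limsup_{N}|A\cap\Phi_N|/|\Phi_N|$ for $A\subset\mathbb{N}$. A function $f\in L^2(\mathbb{N},\Phi)$ is compact along $\Phi$ if for every $\varepsilon>0$ there is $K\in\mathbb{N}$ such that for all $m\in\mathbb{N}$ one has $\min_{1\le k\le K}\|R^mf-R^kf\|_\Phi<\varepsilon$.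 It is weak mixing along $\Phi$ if for every bounded $h:\mathbb{N}\to\mathbb{C}$ and every subsequence $\Psi$ of $\Phi$ such that $\langle R^nf,h\rangle_\Psi$ exists for all $n\in\mathbb{N}$, one has $\overline{d}_\Psi(\{n\in\mathbb{N}:|\langle R^nf,h\rangle_\Psi|>\varepsilon\})=0$ for all $\varepsilon>0$. Theorem. Let $\Phi$ be a Følner sequence in $\mathbb{N}$ and let $f\in L^2(\mathbb{N},\Phi)$. Then there are a subsequence $\Psi$ of $\Phi$ and functions $f_c,f_{wm}\in L^2(\mathbb{N},\Psi)$ such that $f_c$ is compact along $\Psi$, $f_{wm}$ is weak mixing along $\Psi$, and $f=f_c+f_{wm}$ in $L^2(\mathbb{N},\Psi)$, that is, $\|f-(f_c+f_{wm})\|_\Psi=0$. They can be chosen so that, in addition: * if $R^mf\in L^2(\mathbb{N},\Phi)$ for all $m\in\mathbb{N}$ (for example, if $f$ is bounded), then $f(n)=f_c(n)+f_{wm}(n)$ for every $n\in\mathbb{N}$; * for all real $a\le b$, if $f$ is real-valued with $a\le f\le b$, then $f_c$ is real-valued with $a\le f_c\le b$. -/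

import Mathlib

open Filter Topology
open scoped ENNReal

/-- Følner sequences in the additive semigroup of positive integers: sequences of finite non-empty
sets that are asymptotically invariant under every translation. -/
structure IsFolnerSeq (Φ : ℕ → Finset ℕ+) : Prop where
  nonempty : ∀ N, (Φ N).Nonempty
  tendsto : ∀ m : ℕ+, Tendsto
    (fun N => ((symmDiff ((Φ N).image (fun n => n + m)) (Φ N)).card : ℝ) / ((Φ N).card : ℝ))
    atTop (𝓝 0)

/-- `Ψ` is a subsequence of `Φ`. -/
def IsSubseq (Ψ Φ : ℕ → Finset ℕ+) : Prop :=
  ∃ φ : ℕ → ℕ, StrictMono φ ∧ Ψ = Φ ∘ φ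

/-- The shift `(R^m f)(n) = f(n + m)`. -/
def shift (m : ℕ+) (f : ℕ+ → ℂ) : ℕ+ → ℂ :=
  fun n => f (n + m)

/-- The Besicovitch seminorm of `f` along `Φ`, as an extended non-negative number. -/
noncomputable def besSeminorm (Φ : ℕ → Finset ℕ+) (f : ℕ+ → ℂ) : ℝ≥0∞ :=
  (limsup (fun N => (∑ n ∈ Φ N, ‖f n‖ₑ ^ 2) / ((Φ N).card : ℝ≥0∞)) atTop) ^ (1 / 2 : ℝ)

/-- Membership in `L²(ℕ, Φ)`. -/
def MemL2 (Φ : ℕ → Finset ℕ+) (f : ℕ+ → ℂ) : Prop :=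
  besSeminorm Φ f < ∞

/-- The inner product of `f` and `h` along `Φ` exists and equals `c`. -/
def HasInner (Φ : ℕ → Finset ℕ+) (f h : ℕ+ → ℂ) (c : ℂ) : Prop :=
  Tendsto (fun N => (∑ n ∈ Φ N, f n * (starRingEnd ℂ) (h n)) / ((Φ N).card : ℂ)) atTop (𝓝 c)

open scoped Classical in
/-- The upper density of a set of positive integers with respect to `Φ`. -/
noncomputable def upperDensity (Φ : ℕ → Finset ℕ+) (A : Set ℕ+) : ℝ≥0∞ :=
  limsup (fun N => (((Φ N).filter (fun n => n ∈ A)).card : ℝ≥0∞) / ((Φ N).card : ℝ≥0∞)) atTop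

/-- `f` is compact along `Φ` (used for `f` in `L²(ℕ, Φ)`): finitely many of its shifts are
`ε`-dense among all of its shifts. -/
def IsCompactAlong (Φ : ℕ → Finset ℕ+) (f : ℕ+ → ℂ) : Prop :=
  ∀ ε : ℝ, 0 < ε → ∃ K : ℕ+, ∀ m : ℕ+, ∃ k : ℕ+, k ≤ K ∧
    besSeminorm Φ (shift m f - shift k f) < ENNReal.ofReal ε

/-- `f` is weak mixing along `Φ` (used for `f` in `L²(ℕ, Φ)`). Here `c n` is the inner product of
`R^n f` and `h` along `Ψ`. -/
def IsWeakMixingAlong (Φ : ℕ → Finset ℕ+) (f : ℕ+ → ℂ) : Prop :=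
  ∀ h : ℕ+ → ℂ, (∃ C : ℝ, ∀ n, ‖h n‖ ≤ C) →
    ∀ Ψ : ℕ → Finset ℕ+, IsSubseq Ψ Φ →
      ∀ c : ℕ+ → ℂ, (∀ n, HasInner Ψ (shift n f) h (c n)) →
        ∀ ε : ℝ, 0 < ε → upperDensity Ψ {n | ε < ‖c n‖} = 0

/-- `f` is real-valued with values in `[a, b]`. -/
def ValuesIn (f : ℕ+ → ℂ) (a b : ℝ) : Prop :=
  ∀ n, ∃ x : ℝ, f n = (x : ℂ) ∧ a ≤ x ∧ x ≤ b

/-! Averages over $\Phi_N$, taken along an ultrafilter, turn the bounded functions into a Hilbert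
space $H$ on which the shift induces a linear isometry $U$ (`exists_hilbert_of_bounded`). The
truncations of $f$ converge in $H$ to a vector $x$. Let $z$ be its projection to the closed space of
vectors with precompact $U$-orbit; then $z$ should give $f_c$ and $x-z$ should give $f_{wm}$.

The vector $x-z$ is weakly mixing: for $w$ orthogonal to the compact vectors, averages of the
operators $v\mapsto\langle U^nw,v\rangle U^nw$ along a Følner sequence have a weak limit $A$ that
commutes with $U$ and is compact, having finite trace. So $Ay$ is a compact vector; since the
averages take values in the orthogonal complement, $Ay=0$, and the averages of $|\langle
U^nw,y\rangle|^2$ tend to $0$ (`tendsto_mean_sq_inner_of_mem_orthogonal`).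

Vectors of $H$ need not be functions, so $z$ is approximated by bounded $u_N$, and a sparse
subsequence $\Psi$ is chosen along which finitely many correlations of $u_N$ over $\Psi_N$ are
almost those in $H$ (`exists_subsequence_stages`). With $j(q)$ the stage at which $q$ first occurs,
$f_c(q)=u_{j(q)}(q)$ agrees on average with $u_N$ over every fixed translate of $\Psi_N$, because
earlier stages have negligible mass. Compactness then transfers directly. For weak mixing, the
numbers $\langle R^nf_{wm},h\rangle_\Psi$ are dominated by norms in $H$, hence equal $\langle
y,U^n(x-z)\rangle$ for some $y$.

For real bounded $f$ the $u_N$ are clamped to its range, which does not move their limit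
(`tendsto_boundedClamp`). If some shift of $f$ leaves $L^2$, then $f$ is first changed by a null
function (`exists_regular_modification`). -/

/-! ### Precompact sequences -/

/-- A sequence with totally bounded range, phrased through colourings: for every `ε` the index set
splits into finitely many classes on each of which the sequence varies by less than `ε`. -/
def PrecompactSeq {X : Type*} [PseudoMetricSpace X] (a : ℕ → X) : Prop :=
  ∀ ε : ℝ, 0 < ε → ∃ c : ℕ → ℕ, (Set.range c).Finite ∧ ∀ m k, c m = c k → dist (a m) (a k) < ε

namespace PrecompactSeq

variable {X Y : Type*} [PseudoMetricSpace X] [PseudoMetricSpace Y]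

theorem of_totallyBounded {a : ℕ → X} (h : TotallyBounded (Set.range a)) : PrecompactSeq a := by
  intro ε hε
  obtain ⟨t, ht, hcov⟩ := Metric.totallyBounded_iff.1 h (ε / 2) (half_pos hε)
  have hex : ∀ m, ∃ y : t, dist (a m) y < ε / 2 := by
    intro m
    have := hcov ⟨m, rfl⟩
    simp only [Set.mem_iUnion, Metric.mem_ball, exists_prop] at this
    obtain ⟨y, hy, hd⟩ := this
    exact ⟨⟨y, hy⟩, hd⟩
  choose y hy using hex
  have := ht.to_subtype
  obtain ⟨g, hg⟩ := Countable.exists_injective_nat t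
  refine ⟨fun m => g (y m), (Set.finite_range g).subset ?_, ?_⟩
  · rintro _ ⟨m, rfl⟩
    exact ⟨y m, rfl⟩
  · intro m k hmk
    have e : y m = y k := hg hmk
    calc dist (a m) (a k) ≤ dist (a m) (y m) + dist (a k) (y m) := dist_triangle_right _ _ _
      _ < ε / 2 + ε / 2 := add_lt_add (hy m) (e ▸ hy k)
      _ = ε := add_halves ε

theorem of_dist_le {a : ℕ → X} {b : ℕ → Y} (ha : PrecompactSeq a)
    (h : ∀ m k, dist (b m) (b k) ≤ dist (a m) (a k)) : PrecompactSeq b := by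
  intro ε hε
  obtain ⟨c, hc, hd⟩ := ha ε hε
  exact ⟨c, hc, fun m k e => (h m k).trans_lt (hd m k e)⟩

theorem exists_bound {a : ℕ → X} (ha : PrecompactSeq a) {ε : ℝ} (hε : 0 < ε) :
    ∃ K : ℕ, ∀ m, ∃ k ≤ K, dist (a m) (a k) < ε := by
  obtain ⟨c, hc, hd⟩ := ha ε hε
  have hex : ∀ i : Set.range c, ∃ m, c m = i := fun i => i.2
  choose r hr using hex
  have := hc.to_subtype
  obtain ⟨K, hK⟩ := (Set.finite_range r).bddAbove
  exact ⟨K, fun m => ⟨r ⟨c m, m, rfl⟩, hK ⟨_, rfl⟩, hd _ _ (hr ⟨c m, m, rfl⟩).symm⟩⟩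

/-- Pigeonhole on the colours. This is the recurrence that replaces inverting the isometry. -/
theorem exists_lt_dist_lt {a : ℕ → X} (ha : PrecompactSeq a) {ε : ℝ} (hε : 0 < ε) :
    ∃ m k, m < k ∧ dist (a m) (a k) < ε := by
  obtain ⟨c, hc, hd⟩ := ha ε hε
  have := hc.to_subtype
  obtain ⟨m, k, hmk, he⟩ := Finite.exists_ne_map_eq_of_infinite (Set.rangeFactorization c)
  have he' : c m = c k := congrArg Subtype.val he
  rcases lt_or_gt_of_ne hmk with h | h
  · exact ⟨m, k, h, hd _ _ he'⟩
  · exact ⟨k, m, h, hd _ _ he'.symm⟩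

end PrecompactSeq

/-! ### Compact vectors of an isometry -/

section CompactVectors

variable {H : Type*} [NormedAddCommGroup H] [InnerProductSpace ℂ H]

theorem LinearIsometry.pow_add_apply (U : H →ₗᵢ[ℂ] H) (m n : ℕ) (z : H) :
    (U ^ (m + n)) z = (U ^ m) ((U ^ n) z) := by
  rw [pow_add]; rfl

/-- The vectors with relatively compact orbit under a linear isometry. -/
def compactVectors (U : H →ₗᵢ[ℂ] H) : Submodule ℂ H where
  carrier := {z | PrecompactSeq fun n => (U ^ n) z}
  add_mem' := by
    intro y z hy hz ε hε
    obtain ⟨c, hc, hd⟩ := hy (ε / 2) (half_pos hε)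
    obtain ⟨c', hc', hd'⟩ := hz (ε / 2) (half_pos hε)
    -- The common refinement of the two colourings serves the sum.
    refine ⟨fun n => Nat.pair (c n) (c' n), ((hc.prod hc').image (Function.uncurry Nat.pair)).subset
      ?_, ?_⟩
    · rintro _ ⟨n, rfl⟩
      exact ⟨(c n, c' n), ⟨⟨n, rfl⟩, ⟨n, rfl⟩⟩, rfl⟩
    · intro m k h
      obtain ⟨h1, h2⟩ := Nat.pair_eq_pair.1 h
      simp only [map_add]
      exact (dist_add_add_le _ _ _ _).trans_lt
        ((add_lt_add (hd _ _ h1) (hd' _ _ h2)).trans_eq (add_halves ε))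
  zero_mem' := by
    intro ε hε
    refine ⟨fun _ => 0, (Set.finite_singleton 0).subset (by simp), fun m k _ => by simpa using hε⟩
  smul_mem' := by
    intro a z hz ε hε
    obtain ⟨c, hc, hd⟩ := hz (ε / (‖a‖ + 1)) (by positivity)
    refine ⟨c, hc, fun m k h => ?_⟩
    have := hd m k h
    simp only [map_smul, dist_smul₀]
    calc ‖a‖ * dist ((U ^ m) z) ((U ^ k) z) ≤ (‖a‖ + 1) * dist ((U ^ m) z) ((U ^ k) z) := by
          gcongr; linarith
      _ < (‖a‖ + 1) * (ε / (‖a‖ + 1)) := by gcongr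
      _ = ε := by field_simp

theorem isClosed_compactVectors (U : H →ₗᵢ[ℂ] H) : IsClosed (compactVectors U : Set H) := by
  refine isClosed_of_closure_subset fun z hz => ?_
  intro ε hε
  obtain ⟨y, hy, hzy⟩ := Metric.mem_closure_iff.1 hz (ε / 3) (by positivity)
  obtain ⟨c, hc, hd⟩ := hy (ε / 3) (by positivity)
  refine ⟨c, hc, fun m k h => ?_⟩
  have h1 : ∀ n : ℕ, dist ((U ^ n) z) ((U ^ n) y) < ε / 3 := fun n => by
    rwa [LinearIsometry.dist_map]
  calc dist ((U ^ m) z) ((U ^ k) z)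
      ≤ dist ((U ^ m) z) ((U ^ m) y) + dist ((U ^ m) y) ((U ^ k) y)
        + dist ((U ^ k) y) ((U ^ k) z) := dist_triangle4 _ _ _ _
    _ < ε / 3 + ε / 3 + ε / 3 := by
        have := h1 k
        rw [dist_comm] at this
        gcongr
        · exact h1 m
        · exact hd m k h
    _ = ε := by ring

/-- As $U$ need not be surjective, $\langle z,Ux\rangle$ cannot be moved to $\langle
U^{-1}z,x\rangle$. Instead, recurrence puts $z$ close to some $U^{d+1}z$, and $\langle
U^{d+1}z,Ux\rangle=\langle U^dz,x\rangle=0$. -/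
theorem map_mem_orthogonal_compactVectors {U : H →ₗᵢ[ℂ] H} {x : H}
    (hx : x ∈ (compactVectors U)ᗮ) : U x ∈ (compactVectors U)ᗮ := by
  rw [Submodule.mem_orthogonal] at hx ⊢
  intro z hz
  have hmem : ∀ n, (U ^ n) z ∈ compactVectors U := fun n =>
    PrecompactSeq.of_dist_le hz fun m k => by
      rw [← U.pow_add_apply, ← U.pow_add_apply, add_comm m, add_comm k, U.pow_add_apply,
        U.pow_add_apply, LinearIsometry.dist_map]
  by_contra hne
  have hpos : 0 < ‖inner ℂ z (U x)‖ := norm_pos_iff.2 hne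
  obtain ⟨m, k, hmk, hd⟩ := PrecompactSeq.exists_lt_dist_lt hz
    (show 0 < ‖inner ℂ z (U x)‖ / (‖x‖ + 1) by positivity)
  obtain ⟨d, rfl⟩ := Nat.exists_eq_add_of_lt hmk
  have h1 : dist z ((U ^ (d + 1)) z) < ‖inner ℂ z (U x)‖ / (‖x‖ + 1) := by
    rw [add_assoc, U.pow_add_apply, LinearIsometry.dist_map] at hd
    exact hd
  have h2 : inner ℂ ((U ^ (d + 1)) z) (U x) = 0 := by
    rw [add_comm, U.pow_add_apply, pow_one, LinearIsometry.inner_map_map]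
    exact hx _ (hmem d)
  have h3 : inner ℂ z (U x) = inner ℂ (z - (U ^ (d + 1)) z) (U x) := by
    rw [inner_sub_left, h2, sub_zero]
  have h4 : ‖inner ℂ z (U x)‖ ≤ dist z ((U ^ (d + 1)) z) * ‖x‖ := by
    rw [h3, dist_eq_norm]
    exact (norm_inner_le_norm _ _).trans_eq (by rw [U.norm_map])
  have h5 : ‖inner ℂ z (U x)‖ < ‖inner ℂ z (U x)‖ := by
    calc ‖inner ℂ z (U x)‖ ≤ dist z ((U ^ (d + 1)) z) * ‖x‖ := h4
      _ ≤ dist z ((U ^ (d + 1)) z) * (‖x‖ + 1) := by gcongr; linarith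
      _ < ‖inner ℂ z (U x)‖ / (‖x‖ + 1) * (‖x‖ + 1) := by gcongr
      _ = _ := by field_simp
  exact lt_irrefl _ h5

theorem pow_mem_orthogonal_compactVectors {U : H →ₗᵢ[ℂ] H} {x : H}
    (hx : x ∈ (compactVectors U)ᗮ) (n : ℕ) : (U ^ n) x ∈ (compactVectors U)ᗮ := by
  induction n with
  | zero => simpa using hx
  | succ n ih =>
    rw [add_comm, U.pow_add_apply, pow_one]
    exact map_mem_orthogonal_compactVectors ih

end CompactVectors

/-! ### Weak limits and Riesz representation -/

section WeakLimits

variable {H : Type*} [NormedAddCommGroup H] [InnerProductSpace ℂ H] [CompleteSpace H]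

/-- Banach–Alaoglu in the dual; ultrafilters make separability of $H$ unnecessary. -/
theorem exists_weak_limit {α : Type*} (𝒱 : Ultrafilter α) (w : α → H) (C : ℝ)
    (hw : ∀ N, ‖w N‖ ≤ C) :
    ∃ z : H, ∀ v, Tendsto (fun N => inner ℂ (w N) v) 𝒱 (𝓝 (inner ℂ z v)) := by
  let g : α → WeakDual ℂ H := fun N =>
    WeakDual.toStrongDual.symm (InnerProductSpace.toDual ℂ H (w N))
  have hc := WeakDual.isCompact_closedBall (𝕜 := ℂ) (E := H) 0 C
  obtain ⟨l, -, hl⟩ := hc.ultrafilter_le_nhds (𝒱.map g) (by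
    rw [le_principal_iff]
    refine Ultrafilter.mem_map.2 (univ_mem' fun N => ?_)
    simp only [Set.mem_preimage, mem_closedBall_zero_iff]
    simpa [g] using hw N)
  refine ⟨(InnerProductSpace.toDual ℂ H).symm (WeakDual.toStrongDual l), fun v => ?_⟩
  rw [InnerProductSpace.toDual_symm_apply]
  have hl' : Tendsto g 𝒱 (𝓝 l) := hl
  exact ((WeakDual.eval_continuous v).tendsto l).comp hl'

/-- The Riesz representation of scalars dominated by the linear combinations of a family. -/
theorem exists_inner_eq_of_norm_sum_le {ι : Type*} (v : ι → H) (c : ι → ℂ) (C : ℝ)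
    (h : ∀ (s : Finset ι) (a : ι → ℂ), ‖∑ n ∈ s, a n * c n‖ ≤ C * ‖∑ n ∈ s, a n • v n‖) :
    ∃ y : H, ∀ n, c n = inner ℂ y (v n) := by
  let T : (ι →₀ ℂ) →ₗ[ℂ] H := Finsupp.linearCombination ℂ v
  let l : (ι →₀ ℂ) →ₗ[ℂ] ℂ := Finsupp.linearCombination ℂ c
  have hb : ∀ a, ‖l a‖ ≤ C * ‖T a‖ := fun a => by
    simpa [T, l, Finsupp.linearCombination_apply, Finsupp.sum] using h a.support a
  have hker : LinearMap.ker T ≤ LinearMap.ker l := fun a ha => by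
    have := hb a
    rw [LinearMap.mem_ker.1 ha] at this
    simpa using this
  -- The bound makes the functional well defined on the span of the `v n`; Hahn–Banach then extends
  -- it to $H$.
  let g : LinearMap.range T →ₗ[ℂ] ℂ :=
    (LinearMap.ker T).liftQ l hker ∘ₗ T.quotKerEquivRange.symm.toLinearMap
  have hg : ∀ a, g ⟨T a, a, rfl⟩ = l a := fun a => by
    have : T.quotKerEquivRange.symm ⟨T a, a, rfl⟩ = (LinearMap.ker T).mkQ a :=
      T.quotKerEquivRange_symm_apply_image a _
    simp [g, this]
  let g' : StrongDual ℂ (LinearMap.range T) := g.mkContinuous C (by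
    rintro ⟨_, a, rfl⟩
    rw [hg]
    exact hb a)
  obtain ⟨G, hG, -⟩ := exists_extension_norm_eq (LinearMap.range T) g'
  refine ⟨(InnerProductSpace.toDual ℂ H).symm G, fun n => ?_⟩
  rw [InnerProductSpace.toDual_symm_apply]
  have h1 := hG ⟨T (Finsupp.single n 1), _, rfl⟩
  have h2 : g' ⟨T (Finsupp.single n 1), _, rfl⟩ = l (Finsupp.single n 1) := hg _
  rw [h2] at h1
  simpa [T, l] using h1.symm

end WeakLimits

/-! ### Averages over finite sets -/

/-- The average of a real function over a finite set. -/
noncomputable def mean {ι : Type*} (S : Finset ι) (w : ι → ℝ) : ℝ := (∑ n ∈ S, w n) / S.card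

/-- The average over a finite set of a function with values in a complex vector space. -/
noncomputable def cmean {ι E : Type*} [AddCommGroup E] [Module ℂ E] (S : Finset ι) (w : ι → E) : E :=
  (S.card : ℂ)⁻¹ • ∑ n ∈ S, w n

section Means

variable {ι : Type*}

theorem mean_nonneg {S : Finset ι} {w : ι → ℝ} (h : ∀ n ∈ S, 0 ≤ w n) : 0 ≤ mean S w :=
  div_nonneg (Finset.sum_nonneg h) (Nat.cast_nonneg _)

theorem mean_mono {S : Finset ι} {w w' : ι → ℝ} (h : ∀ n ∈ S, w n ≤ w' n) : mean S w ≤ mean S w' :=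
  div_le_div_of_nonneg_right (Finset.sum_le_sum h) (Nat.cast_nonneg _)

theorem mean_add (S : Finset ι) (w w' : ι → ℝ) :
    mean S (fun n => w n + w' n) = mean S w + mean S w' := by
  simp [mean, Finset.sum_add_distrib, add_div]

theorem mean_const_mul (S : Finset ι) (c : ℝ) (w : ι → ℝ) :
    mean S (fun n => c * w n) = c * mean S w := by
  simp [mean, ← Finset.mul_sum, mul_div_assoc]

theorem mean_finset_sum {κ : Type*} (S : Finset ι) (s : Finset κ) (w : κ → ι → ℝ) :
    mean S (fun n => ∑ e ∈ s, w e n) = ∑ e ∈ s, mean S (w e) := by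
  simp only [mean]
  rw [Finset.sum_comm, Finset.sum_div]

theorem mean_le_of_le {S : Finset ι} {w : ι → ℝ} {C : ℝ} (hC : 0 ≤ C) (h : ∀ n ∈ S, w n ≤ C) :
    mean S w ≤ C := by
  rcases S.eq_empty_or_nonempty with rfl | hS
  · simpa [mean] using hC
  · rw [mean, div_le_iff₀ (by exact_mod_cast hS.card_pos)]
    calc ∑ n ∈ S, w n ≤ ∑ _n ∈ S, C := Finset.sum_le_sum h
      _ = C * S.card := by simp [mul_comm]

theorem sq_mean_mul_le (S : Finset ι) (v w : ι → ℝ) :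
    mean S (fun n => v n * w n) ^ 2 ≤ mean S (fun n => v n ^ 2) * mean S (fun n => w n ^ 2) := by
  simp only [mean, div_pow, div_mul_div_comm, ← sq]
  exact div_le_div_of_nonneg_right (Finset.sum_mul_sq_le_sq_mul_sq S v w) (by positivity)

theorem sq_mean_le (S : Finset ι) (w : ι → ℝ) : mean S w ^ 2 ≤ mean S (fun n => w n ^ 2) := by
  have h := sq_mean_mul_le S w (fun _ => 1)
  simp only [mul_one, one_pow] at h
  have h1 : mean S (fun _ => (1 : ℝ)) ≤ 1 := mean_le_of_le zero_le_one (by simp)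
  have h2 : 0 ≤ mean S (fun n => w n ^ 2) := mean_nonneg fun _ _ => sq_nonneg _
  nlinarith

theorem norm_cmean_le {E : Type*} [NormedAddCommGroup E] [NormedSpace ℂ E] (S : Finset ι)
    (w : ι → E) : ‖cmean S w‖ ≤ mean S (fun n => ‖w n‖) := by
  rw [cmean, norm_smul, mean, div_eq_inv_mul]
  simp only [norm_inv, Complex.norm_natCast]
  gcongr
  exact norm_sum_le _ _

theorem cmean_ofReal (S : Finset ι) (w : ι → ℝ) :
    cmean S (fun n => (w n : ℂ)) = (mean S w : ℂ) := by
  simp [cmean, mean, div_eq_inv_mul]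

theorem cmean_add {E : Type*} [AddCommGroup E] [Module ℂ E] (S : Finset ι) (w w' : ι → E) :
    cmean S (fun n => w n + w' n) = cmean S w + cmean S w' := by
  simp [cmean, Finset.sum_add_distrib]

theorem cmean_smul {E : Type*} [AddCommGroup E] [Module ℂ E] (S : Finset ι) (c : ℂ) (w : ι → E) :
    cmean S (fun n => c • w n) = c • cmean S w := by
  simp only [cmean, ← Finset.smul_sum]
  rw [smul_comm]

theorem cmean_finset_sum {κ E : Type*} [AddCommGroup E] [Module ℂ E] (S : Finset ι) (s : Finset κ)
    (w : κ → ι → E) : cmean S (fun n => ∑ e ∈ s, w e n) = ∑ e ∈ s, cmean S (w e) := by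
  simp only [cmean]
  rw [Finset.sum_comm, Finset.smul_sum]

theorem map_cmean {E F 𝓕 : Type*} [AddCommGroup E] [Module ℂ E] [AddCommGroup F] [Module ℂ F]
    [FunLike 𝓕 E F] [LinearMapClass 𝓕 ℂ E F] (T : 𝓕) (S : Finset ι) (w : ι → E) :
    T (cmean S w) = cmean S (fun n => T (w n)) := by
  simp [cmean]

theorem inner_cmean_left {H : Type*} [NormedAddCommGroup H] [InnerProductSpace ℂ H] (S : Finset ι)
    (w : ι → H) (z : H) : inner ℂ (cmean S w) z = cmean S (fun n => inner ℂ (w n) z) := by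
  simp [cmean, mul_comm]

end Means

/-! ### Asymptotic invariance of averages -/

section Folner

theorem norm_sum_shift_sub_le {E : Type*} [NormedAddCommGroup E] (S : Finset ℕ+) (m : ℕ+)
    (w : ℕ+ → E) {C : ℝ} (hw : ∀ n, ‖w n‖ ≤ C) :
    ‖∑ n ∈ S, w (n + m) - ∑ n ∈ S, w n‖ ≤ (symmDiff (S.image fun n => n + m) S).card * C := by
  classical
  have h1 : ∑ n ∈ S, w (n + m) = ∑ n ∈ S.image (fun n => n + m), w n := by
    rw [Finset.sum_image]
    intro a _ b _ h
    exact add_right_cancel h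
  set T := S.image fun n => n + m
  have h2 : ∑ n ∈ T, w n - ∑ n ∈ S, w n = ∑ n ∈ T \ S, w n - ∑ n ∈ S \ T, w n := by
    rw [← Finset.sum_inter_add_sum_sdiff T S, ← Finset.sum_inter_add_sum_sdiff S T,
      Finset.inter_comm S T]
    abel
  have hd : (symmDiff T S).card = (T \ S).card + (S \ T).card := by
    rw [symmDiff_def, Finset.sup_eq_union, Finset.card_union_of_disjoint]
    exact disjoint_sdiff_sdiff
  rw [h1, h2, hd]
  have hb : ∀ R : Finset ℕ+, ‖∑ n ∈ R, w n‖ ≤ R.card * C := fun R =>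
    (norm_sum_le_of_le R fun n _ => hw n).trans_eq (by simp)
  refine (norm_sub_le _ _).trans ?_
  push_cast
  rw [add_mul]
  exact add_le_add (hb _) (hb _)

theorem IsFolnerSeq.tendsto_cmean_shift_sub {S : ℕ → Finset ℕ+} (hS : IsFolnerSeq S)
    {E : Type*} [NormedAddCommGroup E] [NormedSpace ℂ E] (m : ℕ+) (w : ℕ+ → E) {C : ℝ}
    (hw : ∀ n, ‖w n‖ ≤ C) :
    Tendsto (fun N => cmean (S N) (fun n => w (n + m)) - cmean (S N) w) atTop (𝓝 0) := by
  have h := (hS.tendsto m).mul_const C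
  rw [zero_mul] at h
  refine squeeze_zero_norm (fun N => ?_) h
  rw [cmean, cmean, ← smul_sub, norm_smul, norm_inv, Complex.norm_natCast, div_mul_eq_mul_div,
    div_eq_inv_mul]
  gcongr
  exact norm_sum_shift_sub_le (S N) m w hw

end Folner

/-! ### Forms of finite trace -/

section QuadraticForm

variable {H : Type*} [NormedAddCommGroup H] [InnerProductSpace ℂ H]

/-- A non-negative quadratic form of finite trace is small off a finite-dimensional subspace. -/
theorem exists_finiteDimensional_le_of_sum_le (q : H → ℝ)
    (hq : ∀ (c : ℝ) u, q ((c : ℂ) • u) = c ^ 2 * q u) (C : ℝ)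
    (htr : ∀ s : Finset H, Orthonormal ℂ ((↑) : s → H) → ∑ e ∈ s, q e ≤ C) {ε : ℝ} (hε : 0 < ε) :
    ∃ V : Submodule ℂ H, FiniteDimensional ℂ V ∧ ∀ u ∈ Vᗮ, q u ≤ ε * ‖u‖ ^ 2 := by
  classical
  let T : Set ℝ := {r | ∃ s : Finset H, Orthonormal ℂ ((↑) : s → H) ∧ r = ∑ e ∈ s, q e}
  have hne : T.Nonempty := ⟨_, ∅, 
    ⟨fun i => absurd i.2 (Finset.notMem_empty _), fun i => absurd i.2 (Finset.notMem_empty _)⟩, rfl⟩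
  have hbd : BddAbove T := ⟨C, by rintro _ ⟨s, hs, rfl⟩; exact htr s hs⟩
  -- Take an orthonormal set whose trace is within `ε` of the supremum: a further orthogonal unit
  -- vector can contribute at most `ε`.
  obtain ⟨_, ⟨s, hs, rfl⟩, hlt⟩ := exists_lt_of_lt_csSup hne (sub_lt_self (sSup T) hε)
  refine ⟨Submodule.span ℂ (s : Set H), FiniteDimensional.span_finset ℂ s, fun u hu => ?_⟩
  have hus : ∀ e ∈ s, inner ℂ e u = 0 := fun e he =>
    (Submodule.mem_orthogonal _ _).1 hu e (Submodule.subset_span he)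
  rcases eq_or_ne u 0 with rfl | hu0
  · have := hq 0 0
    rw [smul_zero, zero_pow two_ne_zero, zero_mul] at this
    simp [this]
  have hun : ‖u‖ ≠ 0 := norm_ne_zero_iff.2 hu0
  let e : H := ((‖u‖⁻¹ : ℝ) : ℂ) • u
  have he1 : ‖e‖ = 1 := by simp [e, norm_smul, hun]
  have hes : ∀ d ∈ s, inner ℂ d e = 0 := fun d hd => by simp [e, hus d hd]
  have hemem : e ∉ s := fun h => by
    have := hes e h
    rw [inner_self_eq_zero] at this
    simp [this] at he1
  have hs' : Orthonormal ℂ ((↑) : ↥(insert e s) → H) := by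
    constructor
    · rintro ⟨d, hd⟩
      rcases Finset.mem_insert.1 hd with rfl | hd
      · exact he1
      · exact hs.1 ⟨d, hd⟩
    · rintro ⟨d, hd⟩ ⟨d', hd'⟩ hne
      have hne' : d ≠ d' := fun h => hne (Subtype.ext h)
      change inner ℂ d d' = 0
      rcases Finset.mem_insert.1 hd with rfl | h1 <;> rcases Finset.mem_insert.1 hd' with h2 | h2
      · exact absurd h2.symm hne'
      · rw [← inner_conj_symm, hes d' h2, map_zero]
      · rw [h2]; exact hes d h1
      · exact hs.2 (i := ⟨d, h1⟩) (j := ⟨d', h2⟩) fun h => hne' (congrArg Subtype.val h)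
  have hle := le_csSup hbd ⟨_, hs', rfl⟩
  rw [Finset.sum_insert hemem] at hle
  have hqe : q e ≤ ε := by linarith
  have hqu : q u = ‖u‖ ^ 2 * q e := by
    simp only [e]
    rw [hq, ← mul_assoc, ← mul_pow, mul_inv_cancel₀ hun, one_pow, one_mul]
  rw [hqu, mul_comm]
  gcongr

end QuadraticForm

/-! ### Weak mixing off the compact vectors -/

section WeakMixing

variable {H : Type*} [NormedAddCommGroup H] [InnerProductSpace ℂ H]

/-- The average over `S` of the rank-one operators `u ↦ ⟪v n, u⟫ • v n`. -/
noncomputable def rankOneMean {ι : Type*} (v : ι → H) (S : Finset ι) (u : H) : H :=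
  cmean S fun n => inner ℂ (v n) u • v n

section RankOne

variable {ι : Type*} (v : ι → H) (S : Finset ι)

theorem rankOneMean_add (u w : H) :
    rankOneMean v S (u + w) = rankOneMean v S u + rankOneMean v S w := by
  simp [rankOneMean, add_smul, cmean_add]

theorem rankOneMean_smul (c : ℂ) (u : H) :
    rankOneMean v S (c • u) = c • rankOneMean v S u := by
  simp only [rankOneMean, inner_smul_right, mul_smul, cmean_smul]

theorem inner_rankOneMean_self (u : H) :
    inner ℂ (rankOneMean v S u) u = ((mean S fun n => ‖inner ℂ (v n) u‖ ^ 2 : ℝ) : ℂ) := by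
  rw [rankOneMean, inner_cmean_left, ← cmean_ofReal]
  congr 1
  ext n
  rw [inner_smul_left, ← Complex.normSq_eq_conj_mul_self, Complex.normSq_eq_norm_sq]

/-- Cauchy–Schwarz. The right side is $C^2\langle Tu,u\rangle$ for the averaged operator $T$, a
bound that survives weak limits. -/
theorem sq_norm_rankOneMean_le {C : ℝ} (hv : ∀ n, ‖v n‖ ≤ C) (u : H) :
    ‖rankOneMean v S u‖ ^ 2 ≤ C ^ 2 * mean S (fun n => ‖inner ℂ (v n) u‖ ^ 2) := by
  calc ‖rankOneMean v S u‖ ^ 2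
      ≤ (mean S fun n => ‖inner ℂ (v n) u‖ * ‖v n‖) ^ 2 := by
        gcongr
        refine (norm_cmean_le _ _).trans_eq ?_
        simp only [norm_smul]
    _ ≤ _ := sq_mean_mul_le _ _ _
    _ ≤ (mean S fun n => ‖inner ℂ (v n) u‖ ^ 2) * C ^ 2 := by
        gcongr
        · exact mean_nonneg fun _ _ => sq_nonneg _
        · refine mean_le_of_le (sq_nonneg _) fun n _ => ?_
          gcongr
          exact hv n
    _ = _ := mul_comm _ _

theorem mean_sq_inner_le {C : ℝ} (hv : ∀ n, ‖v n‖ ≤ C) (u : H) :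
    mean S (fun n => ‖inner ℂ (v n) u‖ ^ 2) ≤ C ^ 2 * ‖u‖ ^ 2 := by
  refine mean_le_of_le (by positivity) fun n _ => ?_
  rw [← mul_pow]
  gcongr
  exact (norm_inner_le_norm _ _).trans (by gcongr; exact hv n)

theorem norm_rankOneMean_le {C : ℝ} (hC : 0 ≤ C) (hv : ∀ n, ‖v n‖ ≤ C) (u : H) :
    ‖rankOneMean v S u‖ ≤ C ^ 2 * ‖u‖ := by
  refine (sq_le_sq₀ (norm_nonneg _) (by positivity)).1 ?_
  refine (sq_norm_rankOneMean_le v S hv u).trans ?_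
  calc C ^ 2 * mean S (fun n => ‖inner ℂ (v n) u‖ ^ 2) ≤ C ^ 2 * (C ^ 2 * ‖u‖ ^ 2) := by
        gcongr; exact mean_sq_inner_le v S hv u
    _ = _ := by ring

end RankOne

/-- A weak limit of averages of rank-one operators maps bounded sequences to precompact ones, as it
has finite trace. -/
theorem precompactSeq_of_weak_limit {ι : Type*} (v : ι → H) {C : ℝ} (hC : 0 ≤ C)
    (hv : ∀ n, ‖v n‖ ≤ C) (S : ℕ → Finset ι) (𝒱 : Ultrafilter ℕ) (A : H → H)
    (hA : ∀ u w, Tendsto (fun N => inner ℂ (rankOneMean v (S N) u) w) 𝒱 (𝓝 (inner ℂ (A u) w)))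
    (y : ℕ → H) {B : ℝ} (hy : ∀ m, ‖y m‖ ≤ B) : PrecompactSeq fun m => A (y m) := by
  classical
  have hAadd : ∀ u w, A (u + w) = A u + A w := fun u w => by
    refine ext_inner_right ℂ fun z => ?_
    refine tendsto_nhds_unique (hA (u + w) z) ?_
    simp only [rankOneMean_add, inner_add_left]
    exact (hA u z).add (hA w z)
  have hAsmul : ∀ (c : ℂ) u, A (c • u) = c • A u := fun c u => by
    refine ext_inner_right ℂ fun z => ?_
    refine tendsto_nhds_unique (hA (c • u) z) ?_
    simp only [rankOneMean_smul, inner_smul_left]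
    exact (hA u z).const_mul _
  let q : H → ℝ := fun u => (inner ℂ (A u) u).re
  have hq : ∀ u, Tendsto (fun N => mean (S N) fun n => ‖inner ℂ (v n) u‖ ^ 2) 𝒱 (𝓝 (q u)) :=
    fun u => by
      have := (Complex.continuous_re.tendsto _).comp (hA u u)
      simp only [Function.comp_def, inner_rankOneMean_self, Complex.ofReal_re] at this
      exact this
  have hqhom : ∀ (c : ℝ) u, q ((c : ℂ) • u) = c ^ 2 * q u := fun c u => by
    simp only [q]
    rw [hAsmul, inner_smul_left, inner_smul_right, Complex.conj_ofReal, ← mul_assoc,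
      ← Complex.ofReal_mul, Complex.re_ofReal_mul, sq]
  have hqC : ∀ u, q u ≤ C ^ 2 * ‖u‖ ^ 2 := fun u =>
    le_of_tendsto (hq u) (Eventually.of_forall fun N => mean_sq_inner_le v (S N) hv u)
  have htr : ∀ s : Finset H, Orthonormal ℂ ((↑) : s → H) → ∑ e ∈ s, q e ≤ C ^ 2 := by
    intro s hs
    refine le_of_tendsto (tendsto_finsetSum s fun e _ => hq e) (Eventually.of_forall fun N => ?_)
    rw [← mean_finset_sum]
    refine mean_le_of_le (sq_nonneg _) fun n _ => ?_
    have h := hs.sum_inner_products_le (v n) (s := Finset.univ)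
    calc ∑ e ∈ s, ‖inner ℂ (v n) e‖ ^ 2 = ∑ e : s, ‖inner ℂ (e : H) (v n)‖ ^ 2 := by
          rw [← Finset.sum_coe_sort s]
          exact Finset.sum_congr rfl fun e _ => by rw [norm_inner_symm]
      _ ≤ ‖v n‖ ^ 2 := h
      _ ≤ C ^ 2 := by gcongr; exact hv n
  -- Norms are not weakly continuous, so the bound is tested against the fixed vector `A u` before
  -- passing to the limit.
  have hAq : ∀ u, ‖A u‖ ^ 2 ≤ C ^ 2 * q u := fun u => by
    have h1 := ((hA u (A u)).norm.pow 2)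
    have h2 : ‖inner ℂ (A u) (A u)‖ ^ 2 ≤ C ^ 2 * q u * ‖A u‖ ^ 2 := by
      refine le_of_tendsto_of_tendsto h1 (((hq u).const_mul (C ^ 2)).mul_const (‖A u‖ ^ 2))
        (Eventually.of_forall fun N => ?_)
      calc ‖inner ℂ (rankOneMean v (S N) u) (A u)‖ ^ 2
          ≤ (‖rankOneMean v (S N) u‖ * ‖A u‖) ^ 2 := by gcongr; exact norm_inner_le_norm _ _
        _ = ‖rankOneMean v (S N) u‖ ^ 2 * ‖A u‖ ^ 2 := mul_pow _ _ _
        _ ≤ _ := mul_le_mul_of_nonneg_right (sq_norm_rankOneMean_le v (S N) hv u) (sq_nonneg _)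
    have h3 : ‖inner ℂ (A u) (A u)‖ = ‖A u‖ ^ 2 := by rw [inner_self_eq_norm_sq_to_K]; simp
    rw [h3] at h2
    rcases eq_or_ne (A u) 0 with h0 | h0
    · have : 0 ≤ q u := ge_of_tendsto (hq u)
        (Eventually.of_forall fun N => mean_nonneg fun _ _ => sq_nonneg _)
      rw [h0, norm_zero, zero_pow two_ne_zero]
      exact mul_nonneg (sq_nonneg _) this
    · have : 0 < ‖A u‖ ^ 2 := by positivity
      nlinarith
  intro ε hε
  have hB : 0 ≤ B := (norm_nonneg _).trans (hy 0)
  -- The threshold gives $C^2q\le(\varepsilon/2)^2$ on vectors of $V^\perp$ of norm at most $2B$,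
  -- the size of differences of the `y m`; the `+ 1` keeps the denominator positive.
  obtain ⟨V, hVfin, hV⟩ := exists_finiteDimensional_le_of_sum_le q hqhom (C ^ 2) htr
    (show 0 < (ε / 2) ^ 2 / (C ^ 2 * (2 * B) ^ 2 + 1) by positivity)
  have hpre : PrecompactSeq fun m => V.orthogonalProjectionOnto (y m) := by
    refine PrecompactSeq.of_totallyBounded ?_
    have : ProperSpace V := FiniteDimensional.proper ℂ V
    refine TotallyBounded.subset subset_closure (Bornology.IsBounded.isCompact_closure
      (isBounded_iff_forall_norm_le.2 ⟨B, ?_⟩)).totallyBounded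
    rintro _ ⟨m, rfl⟩
    exact (V.norm_orthogonalProjectionOnto_apply_le _).trans (hy m)
  obtain ⟨c, hc, hd⟩ := hpre (ε / 2 / (C ^ 2 + 1)) (by positivity)
  refine ⟨c, hc, fun m k hmk => ?_⟩
  have hlt := hd m k hmk
  set t := y m - y k with ht
  have hAt : A (y m) = A t + A (y k) := by rw [← hAadd, ht, sub_add_cancel]
  let p : H := V.orthogonalProjectionOnto t
  have hp : ‖p‖ < ε / 2 / (C ^ 2 + 1) := by
    rw [dist_eq_norm, ← map_sub, ← ht] at hlt
    exact hlt
  have hsplit : A t = A p + A (t - p) := by rw [← hAadd, add_sub_cancel]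
  have hAp : ‖A p‖ < ε / 2 := by
    have h1 : ‖A p‖ ≤ C ^ 2 * ‖p‖ := by
      refine (sq_le_sq₀ (norm_nonneg _) (by positivity)).1 ((hAq p).trans ?_)
      calc C ^ 2 * q p ≤ C ^ 2 * (C ^ 2 * ‖p‖ ^ 2) := by gcongr; exact hqC p
        _ = _ := by ring
    calc ‖A p‖ ≤ C ^ 2 * ‖p‖ := h1
      _ ≤ (C ^ 2 + 1) * ‖p‖ := by gcongr; linarith
      _ < (C ^ 2 + 1) * (ε / 2 / (C ^ 2 + 1)) := by gcongr
      _ = ε / 2 := by field_simp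
  have hperp : t - p ∈ Vᗮ := V.sub_starProjection_mem_orthogonal t
  have htp : ‖t - p‖ ≤ 2 * B := by
    have h1 : ‖t - p‖ ≤ ‖t‖ := by
      have h2 := V.norm_sq_eq_add_norm_sq_projection t
      have h3 : inner ℂ p (t - p) = 0 :=
        (Submodule.mem_orthogonal _ _).1 hperp p (Submodule.coe_mem _)
      have h4 := norm_add_sq_eq_norm_sq_add_norm_sq_of_inner_eq_zero (𝕜 := ℂ) p (t - p) h3
      rw [add_sub_cancel] at h4
      nlinarith [norm_nonneg t, norm_nonneg (t - p), norm_nonneg p]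
    refine h1.trans ((norm_sub_le _ _).trans ?_)
    linarith [hy m, hy k]
  have hAp' : ‖A (t - p)‖ ≤ ε / 2 := by
    refine (sq_le_sq₀ (norm_nonneg _) (by positivity)).1 ((hAq _).trans ?_)
    have hD : 0 < C ^ 2 * (2 * B) ^ 2 + 1 := by positivity
    calc C ^ 2 * q (t - p)
        ≤ C ^ 2 * ((ε / 2) ^ 2 / (C ^ 2 * (2 * B) ^ 2 + 1) * (2 * B) ^ 2) := by
          gcongr
          refine (hV _ hperp).trans ?_
          gcongr
      _ = (ε / 2) ^ 2 * ((C ^ 2 * (2 * B) ^ 2) / (C ^ 2 * (2 * B) ^ 2 + 1)) := by ring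
      _ ≤ (ε / 2) ^ 2 * 1 := by
          gcongr
          rw [div_le_one hD]
          linarith
      _ = _ := mul_one _
  change dist (A (y m)) (A (y k)) < ε
  rw [dist_eq_norm, hAt, add_sub_cancel_right, hsplit]
  linarith [norm_add_le (A p) (A (t - p))]

/-- The orbit of a vector orthogonal to the compact vectors is weakly mixing along every Følner
sequence. -/
theorem tendsto_mean_sq_inner_of_mem_orthogonal [CompleteSpace H] {U : H →ₗᵢ[ℂ] H} {x : H}
    (hx : x ∈ (compactVectors U)ᗮ) {S : ℕ → Finset ℕ+} (hS : IsFolnerSeq S) (y : H) :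
    Tendsto (fun N => mean (S N) fun n => ‖inner ℂ ((U ^ (n : ℕ)) x) y‖ ^ 2) atTop (𝓝 0) := by
  rw [tendsto_iff_ultrafilter]
  intro 𝒱 h𝒱
  let v : ℕ+ → H := fun n => (U ^ (n : ℕ)) x
  have hv : ∀ n, ‖v n‖ ≤ ‖x‖ := fun n => (LinearIsometry.norm_map _ _).le
  have hex : ∀ u, ∃ z : H, ∀ w,
      Tendsto (fun N => inner ℂ (rankOneMean v (S N) u) w) 𝒱 (𝓝 (inner ℂ z w)) := fun u =>
    exists_weak_limit 𝒱 _ _ fun N => norm_rankOneMean_le v (S N) (norm_nonneg x) hv u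
  choose A hA using hex
  have hcomm : ∀ u, A (U u) = U (A u) := fun u => by
    refine ext_inner_right ℂ fun z => ?_
    have h1 : Tendsto (fun N => inner ℂ (U (rankOneMean v (S N) u)) z) 𝒱
        (𝓝 (inner ℂ (U (A u)) z)) := by
      have := hA u (ContinuousLinearMap.adjoint U.toContinuousLinearMap z)
      simp only [ContinuousLinearMap.adjoint_inner_right] at this
      exact this
    let w : ℕ+ → H := fun n => inner ℂ (v n) (U u) • v n
    have hw : ∀ n, ‖w n‖ ≤ ‖x‖ * ‖u‖ * ‖x‖ := fun n => by
      rw [norm_smul]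
      gcongr
      · refine (norm_inner_le_norm _ _).trans ?_
        rw [U.norm_map]
        gcongr
        exact hv n
      · exact hv n
    -- Since $v_{n+1}=Uv_n$, applying $U$ to the average at $u$ translates by one the average at
    -- $Uu$, and Følner averages ignore the translation.
    have h2 : ∀ N, U (rankOneMean v (S N) u) = cmean (S N) (fun n => w (n + 1)) := fun N => by
      rw [rankOneMean, map_cmean]
      congr 1
      ext n
      have e : v (n + 1) = U (v n) := by
        simp only [v, PNat.add_coe, PNat.one_coe]
        rw [add_comm, U.pow_add_apply, pow_one]
      simp only [w, e, LinearIsometry.inner_map_map, map_smul]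
    have h3 := ((hS.tendsto_cmean_shift_sub 1 w hw).mono_left h𝒱).inner (tendsto_const_nhds (x := z))
      (𝕜 := ℂ)
    rw [inner_zero_left] at h3
    have h4 := h1.sub h3
    rw [sub_zero] at h4
    refine tendsto_nhds_unique (hA (U u) z) (h4.congr fun N => ?_)
    rw [h2, ← inner_sub_left, sub_sub_cancel]
    rfl
  have hpow : ∀ m : ℕ, A ((U ^ m) y) = (U ^ m) (A y) := fun m => by
    induction m with
    | zero => simp
    | succ m ih =>
      rw [add_comm, U.pow_add_apply, U.pow_add_apply, pow_one, hcomm, ih]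
  have hmem : A y ∈ compactVectors U := by
    have := precompactSeq_of_weak_limit v (norm_nonneg x) hv S 𝒱 A hA (fun m => (U ^ m) y)
      (B := ‖y‖) fun m => (LinearIsometry.norm_map _ _).le
    simp only [hpow] at this
    exact this
  have hperp : inner ℂ (A y) (A y) = 0 := by
    refine tendsto_nhds_unique (hA y (A y)) ?_
    have : ∀ N, inner ℂ (rankOneMean v (S N) y) (A y) = 0 := fun N => by
      rw [rankOneMean, inner_cmean_left]
      have : ∀ n, inner ℂ (inner ℂ (v n) y • v n) (A y) = 0 := fun n => by
        rw [inner_smul_left, (Submodule.mem_orthogonal' _ _).1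
          (pow_mem_orthogonal_compactVectors hx n) _ hmem, mul_zero]
      simp [this, cmean]
    simp only [this]
    exact tendsto_const_nhds
  have hA0 : A y = 0 := inner_self_eq_zero.1 hperp
  have h5 := (Complex.continuous_re.tendsto _).comp (hA y y)
  simp only [Function.comp_def, inner_rankOneMean_self, Complex.ofReal_re, hA0, inner_zero_left,
    Complex.zero_re] at h5
  exact h5

end WeakMixing

/-! ### The Hilbert space of bounded functions -/

/-- The Hilbert space of a positive semidefinite form on a complex vector space, together with the
isometry induced by a linear map that preserves the form. -/
theorem exists_hilbert_completion {E : Type} [AddCommGroup E] [Module ℂ E]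
    (c : PreInnerProductSpace.Core ℂ E) (T : E →ₗ[ℂ] E)
    (hT : ∀ f g, c.inner (T f) (T g) = c.inner f g) :
    ∃ (H : Type) (_ : NormedAddCommGroup H) (_ : InnerProductSpace ℂ H) (_ : CompleteSpace H)
      (ι : E →ₗ[ℂ] H) (U : H →ₗᵢ[ℂ] H), DenseRange ι ∧ (∀ f g, inner ℂ (ι f) (ι g) = c.inner f g) ∧
        ∀ f, U (ι f) = ι (T f) := by
  let _ : SeminormedAddCommGroup E := InnerProductSpace.Core.toSeminormedAddCommGroup (c := c)
  let _ : InnerProductSpace ℂ E := InnerProductSpace.ofCore c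
  have hinner : ∀ f g : E, inner ℂ f g = c.inner f g := fun f g => rfl
  have hnorm : ∀ f, ‖T f‖ = ‖f‖ := fun f => by
    rw [@norm_eq_sqrt_re_inner ℂ, @norm_eq_sqrt_re_inner ℂ, hinner, hinner, hT]
  let T' : E →L[ℂ] E := T.mkContinuous 1 fun f => by rw [hnorm, one_mul]
  let U : UniformSpace.Completion E →ₗᵢ[ℂ] UniformSpace.Completion E :=
    { toLinearMap := T'.completion.toLinearMap
      norm_map' := fun z => by
        refine UniformSpace.Completion.induction_on z ?_ fun f => ?_
        · exact isClosed_eq (T'.completion.continuous.norm) continuous_norm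
        · change ‖T'.completion f‖ = _
          rw [ContinuousLinearMap.completion_apply_coe, UniformSpace.Completion.norm_coe,
            UniformSpace.Completion.norm_coe]
          exact hnorm f }
  refine ⟨UniformSpace.Completion E, inferInstance, inferInstance, inferInstance,
    (UniformSpace.Completion.toComplL (𝕜 := ℂ) (E := E)).toLinearMap, U, ?_, ?_, ?_⟩
  · exact UniformSpace.Completion.denseRange_coe
  · intro f g
    exact (UniformSpace.Completion.inner_coe f g).trans (hinner f g)
  · intro f
    exact T'.completion_apply_coe f

/-- The space of bounded complex functions on the positive integers. -/
def boundedFunctions : Submodule ℂ (ℕ+ → ℂ) where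
  carrier := {f | ∃ C : ℝ, ∀ n, ‖f n‖ ≤ C}
  add_mem' := by
    rintro f g ⟨C, hC⟩ ⟨D, hD⟩
    exact ⟨C + D, fun n => (norm_add_le _ _).trans (add_le_add (hC n) (hD n))⟩
  zero_mem' := ⟨0, fun n => by simp⟩
  smul_mem' := by
    rintro a f ⟨C, hC⟩
    exact ⟨‖a‖ * C, fun n => (norm_smul_le a (f n)).trans (mul_le_mul_of_nonneg_left (hC n) (norm_nonneg a))⟩

/-- The sum of a positive integer and a natural number. -/
def natAdd (n : ℕ+) (m : ℕ) : ℕ+ := ⟨n + m, Nat.add_pos_left n.pos m⟩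

theorem natAdd_injective (m : ℕ) : Function.Injective fun n => natAdd n m := fun a b h => by
  have : (a : ℕ) + m = b + m := congrArg PNat.val h
  exact PNat.eq (Nat.add_right_cancel this)

/-- The shift of a function on the positive integers by a natural number. -/
def natShift (m : ℕ) (f : ℕ+ → ℂ) : ℕ+ → ℂ := fun n => f (natAdd n m)

theorem shift_eq_natShift (m : ℕ+) (f : ℕ+ → ℂ) : shift m f = natShift m f := rfl

theorem natShift_zero (f : ℕ+ → ℂ) : natShift 0 f = f := rfl

theorem natShift_natShift (m k : ℕ) (f : ℕ+ → ℂ) :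
    natShift m (natShift k f) = natShift (m + k) f := by
  ext n
  simp only [natShift, natAdd]
  congr 2
  simp [add_assoc]

/-- The shift by one on bounded functions. -/
def boundedShift : boundedFunctions →ₗ[ℂ] boundedFunctions where
  toFun f := ⟨natShift 1 f, by
    obtain ⟨C, hC⟩ := f.2
    exact ⟨C, fun n => hC _⟩⟩
  map_add' _ _ := rfl
  map_smul' _ _ := rfl

/-- The space of bounded functions with the inner product given by averages along an ultrafilter,
realised in a Hilbert space on which the shift acts isometrically. -/
theorem exists_hilbert_of_bounded (Φ : ℕ → Finset ℕ+) (hΦ : IsFolnerSeq Φ) (𝒰 : Ultrafilter ℕ)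
    (h𝒰 : (𝒰 : Filter ℕ) ≤ atTop) :
    ∃ (H : Type) (_ : NormedAddCommGroup H) (_ : InnerProductSpace ℂ H) (_ : CompleteSpace H)
      (ι : boundedFunctions →ₗ[ℂ] H) (U : H →ₗᵢ[ℂ] H), DenseRange ι ∧
        (∀ f g : boundedFunctions, Tendsto
          (fun N => cmean (Φ N) fun n => (starRingEnd ℂ) (f.1 n) * g.1 n) 𝒰
          (𝓝 (inner ℂ (ι f) (ι g)))) ∧
        ∀ f, U (ι f) = ι (boundedShift f) := by
  let a : boundedFunctions → boundedFunctions → ℕ → ℂ := fun f g N =>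
    cmean (Φ N) fun n => (starRingEnd ℂ) (f.1 n) * g.1 n
  have hbd : ∀ f g : boundedFunctions, ∃ C : ℝ, ∀ n, ‖(starRingEnd ℂ) (f.1 n) * g.1 n‖ ≤ C := by
    intro f g
    obtain ⟨C, hC⟩ := f.2
    obtain ⟨D, hD⟩ := g.2
    refine ⟨C * D, fun n => ?_⟩
    rw [norm_mul, RCLike.norm_conj]
    have := (norm_nonneg _).trans (hC n)
    gcongr
    · exact hC n
    · exact hD n
  have hex : ∀ f g, ∃ l, Tendsto (a f g) 𝒰 (𝓝 l) := fun f g => by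
    obtain ⟨C, hC⟩ := hbd f g
    obtain ⟨l, -, hl⟩ := (isCompact_closedBall (0 : ℂ) C).ultrafilter_le_nhds (𝒰.map (a f g)) (by
      rw [le_principal_iff]
      refine Ultrafilter.mem_map.2 (univ_mem' fun N => ?_)
      rw [Set.mem_preimage, mem_closedBall_zero_iff]
      exact (norm_cmean_le _ _).trans
        (mean_le_of_le ((norm_nonneg _).trans (hC 1)) fun n _ => hC n))
    exact ⟨l, hl⟩
  choose B hB using hex
  let c : PreInnerProductSpace.Core ℂ boundedFunctions :=
    { inner := B
      conj_inner_symm := fun f g => by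
        refine tendsto_nhds_unique ?_ (hB f g)
        refine ((Complex.continuous_conj.tendsto _).comp (hB g f)).congr fun N => ?_
        simp [a, cmean, map_sum, mul_comm]
      re_inner_nonneg := fun f => by
        refine ge_of_tendsto ((Complex.continuous_re.tendsto _).comp (hB f f))
          (Eventually.of_forall fun N => ?_)
        have : a f f N = (mean (Φ N) (fun n => ‖f.1 n‖ ^ 2) : ℝ) := by
          rw [← cmean_ofReal]
          simp only [a, ← Complex.normSq_eq_conj_mul_self, Complex.normSq_eq_norm_sq]
        simp only [Function.comp, this, Complex.ofReal_re]
        exact mean_nonneg fun _ _ => sq_nonneg _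
      add_left := fun f g h => by
        refine tendsto_nhds_unique (hB (f + g) h) (((hB f h).add (hB g h)).congr fun N => ?_)
        simp only [a, ← cmean_add]
        congr 1
        ext n
        simp [add_mul]
      smul_left := fun f g r => by
        refine tendsto_nhds_unique (hB (r • f) g) (((hB f g).const_mul _).congr fun N => ?_)
        simp only [a, ← smul_eq_mul, ← cmean_smul]
        congr 1
        ext n
        simp [mul_assoc] }
  obtain ⟨H, i1, i2, i3, ι, U, hd, hi, hU⟩ := exists_hilbert_completion c boundedShift (by
    intro f g
    obtain ⟨C, hC⟩ := hbd f g
    have h1 := (hΦ.tendsto_cmean_shift_sub 1 _ hC).mono_left h𝒰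
    have h2 := h1.add (hB f g)
    rw [zero_add] at h2
    refine tendsto_nhds_unique (hB _ _) (h2.congr fun N => ?_)
    simp only [a, sub_add_cancel]
    rfl)
  refine ⟨H, i1, i2, i3, ι, U, hd, fun f g => ?_, hU⟩
  rw [hi]
  exact hB f g

/-! ### Seminorm, cardinality and density estimates -/

section Seminorm

theorem sum_enorm_sq_div_card {S : Finset ℕ+} (hS : S.Nonempty) (f : ℕ+ → ℂ) :
    (∑ n ∈ S, ‖f n‖ₑ ^ 2) / (S.card : ℝ≥0∞) = ENNReal.ofReal (mean S fun n => ‖f n‖ ^ 2) := by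
  rw [mean, ENNReal.ofReal_div_of_pos (by exact_mod_cast hS.card_pos),
    ENNReal.ofReal_sum_of_nonneg fun _ _ => sq_nonneg _, ENNReal.ofReal_natCast]
  congr 1
  refine Finset.sum_congr rfl fun n _ => ?_
  rw [ENNReal.ofReal_pow (norm_nonneg _), ofReal_norm]

variable {Φ : ℕ → Finset ℕ+} {f g : ℕ+ → ℂ}

theorem besSeminorm_le (hΦ : ∀ N, (Φ N).Nonempty) {r : ℝ} (hr : 0 ≤ r)
    (h : ∀ᶠ N in atTop, mean (Φ N) (fun n => ‖f n‖ ^ 2) ≤ r ^ 2) :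
    besSeminorm Φ f ≤ ENNReal.ofReal r := by
  have h1 : limsup (fun N => (∑ n ∈ Φ N, ‖f n‖ₑ ^ 2) / ((Φ N).card : ℝ≥0∞)) atTop
      ≤ ENNReal.ofReal (r ^ 2) := by
    refine limsup_le_of_le (by isBoundedDefault) (h.mono fun N hN => ?_)
    rw [sum_enorm_sq_div_card (hΦ N)]
    exact ENNReal.ofReal_le_ofReal hN
  calc besSeminorm Φ f ≤ (ENNReal.ofReal (r ^ 2)) ^ (1 / 2 : ℝ) :=
        ENNReal.rpow_le_rpow h1 (by norm_num)
    _ = ENNReal.ofReal r := by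
        rw [ENNReal.ofReal_rpow_of_nonneg (sq_nonneg _) (by norm_num), ← Real.sqrt_eq_rpow,
          Real.sqrt_sq hr]

theorem memL2_of_eventually_le (hΦ : ∀ N, (Φ N).Nonempty) {C : ℝ}
    (h : ∀ᶠ N in atTop, mean (Φ N) (fun n => ‖f n‖ ^ 2) ≤ C) : MemL2 Φ f := by
  refine (besSeminorm_le hΦ (Real.sqrt_nonneg (max C 0)) (h.mono fun N hN => ?_)).trans_lt
    ENNReal.ofReal_lt_top
  rw [Real.sq_sqrt (le_max_right _ _)]
  exact hN.trans (le_max_left _ _)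

theorem MemL2.exists_eventually_le (hΦ : ∀ N, (Φ N).Nonempty) (h : MemL2 Φ f) :
    ∃ C : ℝ, 0 ≤ C ∧ ∀ᶠ N in atTop, mean (Φ N) (fun n => ‖f n‖ ^ 2) ≤ C := by
  have h1 : limsup (fun N => (∑ n ∈ Φ N, ‖f n‖ₑ ^ 2) / ((Φ N).card : ℝ≥0∞)) atTop < ∞ := by
    by_contra hne
    rw [not_lt, top_le_iff] at hne
    rw [MemL2, besSeminorm, hne, ENNReal.top_rpow_of_pos (by norm_num)] at h
    exact lt_irrefl _ h
  obtain ⟨C, hC1, hC2⟩ := ENNReal.lt_iff_exists_nnreal_btwn.1 h1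
  refine ⟨C, C.2, (eventually_lt_of_limsup_lt hC1).mono fun N hN => ?_⟩
  rw [sum_enorm_sq_div_card (hΦ N), ← ENNReal.ofReal_coe_nnreal] at hN
  exact (ENNReal.ofReal_lt_ofReal_iff_of_nonneg (mean_nonneg fun _ _ => sq_nonneg _)).1 hN |>.le

theorem besSeminorm_eq_zero (hΦ : ∀ N, (Φ N).Nonempty)
    (h : Tendsto (fun N => mean (Φ N) fun n => ‖f n‖ ^ 2) atTop (𝓝 0)) : besSeminorm Φ f = 0 := by
  refine le_antisymm (ENNReal.le_of_forall_pos_le_add fun ε hε _ => ?_) (zero_le)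
  rw [zero_add]
  have hε' : (0 : ℝ) < ε := hε
  refine (besSeminorm_le hΦ hε'.le ((h.eventually_lt_const (sq_pos_of_pos hε')).mono
    fun N hN => hN.le)).trans_eq ENNReal.ofReal_coe_nnreal

theorem mean_sq_norm_add_le (S : Finset ℕ+) (f g : ℕ+ → ℂ) :
    mean S (fun n => ‖f n + g n‖ ^ 2)
      ≤ 2 * mean S (fun n => ‖f n‖ ^ 2) + 2 * mean S (fun n => ‖g n‖ ^ 2) := by
  rw [← mean_const_mul, ← mean_const_mul, ← mean_add]
  refine mean_mono fun n _ => ?_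
  nlinarith [norm_add_le (f n) (g n), norm_nonneg (f n + g n), sq_nonneg (‖f n‖ - ‖g n‖)]

theorem mean_sq_norm_sub_le (S : Finset ℕ+) (f g : ℕ+ → ℂ) :
    mean S (fun n => ‖f n - g n‖ ^ 2)
      ≤ 2 * mean S (fun n => ‖f n‖ ^ 2) + 2 * mean S (fun n => ‖g n‖ ^ 2) := by
  simpa [sub_eq_add_neg] using mean_sq_norm_add_le S f fun n => -g n

/-- The translate of the maximum by one always lies in the symmetric difference, so $1/|\Phi_N|$ is
at most the Følner ratio. -/
theorem IsFolnerSeq.tendsto_card {Φ : ℕ → Finset ℕ+} (hΦ : IsFolnerSeq Φ) :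
    Tendsto (fun N => ((Φ N).card : ℝ)) atTop atTop := by
  have hpos : ∀ N, (0 : ℝ) < (Φ N).card := fun N => by exact_mod_cast (hΦ.nonempty N).card_pos
  have h : Tendsto (fun N => ((Φ N).card : ℝ)⁻¹) atTop (𝓝 0) := by
    refine squeeze_zero (fun N => (inv_pos.2 (hpos N)).le) (fun N => ?_) (hΦ.tendsto 1)
    rw [inv_eq_one_div]
    refine div_le_div_of_nonneg_right ?_ (hpos N).le
    have : (symmDiff ((Φ N).image fun n => n + 1) (Φ N)).Nonempty := by
      refine ⟨(Φ N).max' (hΦ.nonempty N) + 1, Finset.mem_symmDiff.2 (Or.inl ⟨?_, fun hm => ?_⟩)⟩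
      · exact Finset.mem_image_of_mem _ (Finset.max'_mem _ _)
      · exact absurd ((Φ N).le_max' _ hm) (not_le.2 (PNat.lt_add_right _ _))
    exact_mod_cast this.card_pos
  have h2 := (tendsto_nhdsWithin_iff.2 ⟨h, Eventually.of_forall fun N => inv_pos.2 (hpos N)⟩ :
    Tendsto (fun N => ((Φ N).card : ℝ)⁻¹) atTop (𝓝[>] 0)).inv_tendsto_nhdsGT_zero
  exact h2.congr fun N => by simp

theorem IsFolnerSeq.comp {Φ : ℕ → Finset ℕ+} (hΦ : IsFolnerSeq Φ) {φ : ℕ → ℕ} (hφ : StrictMono φ) :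
    IsFolnerSeq (Φ ∘ φ) :=
  ⟨fun _ => hΦ.nonempty _, fun m => (hΦ.tendsto m).comp hφ.tendsto_atTop⟩

/-- Chebyshev's inequality. -/
theorem upperDensity_eq_zero (hΦ : ∀ N, (Φ N).Nonempty) {c : ℕ+ → ℂ}
    (h : Tendsto (fun N => mean (Φ N) fun n => ‖c n‖ ^ 2) atTop (𝓝 0)) {ε : ℝ} (hε : 0 < ε) :
    upperDensity Φ {n | ε < ‖c n‖} = 0 := by
  classical
  have hlim : Tendsto (fun N => ENNReal.ofReal ((mean (Φ N) fun n => ‖c n‖ ^ 2) / ε ^ 2)) atTop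
      (𝓝 0) := by
    have := ENNReal.tendsto_ofReal (h.div_const (ε ^ 2))
    simpa using this
  refine (tendsto_of_tendsto_of_tendsto_of_le_of_le tendsto_const_nhds hlim (fun _ => zero_le)
    fun N => ?_).limsup_eq
  have hc : (0 : ℝ) < (Φ N).card := by exact_mod_cast (hΦ N).card_pos
  have hcard : ∀ s : Finset ℕ+, ((s.card : ℝ≥0∞) / (Φ N).card)
      = ENNReal.ofReal ((s.card : ℝ) / (Φ N).card) := fun s => by
    rw [ENNReal.ofReal_div_of_pos hc, ENNReal.ofReal_natCast, ENNReal.ofReal_natCast]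
  beta_reduce
  rw [hcard]
  refine ENNReal.ofReal_le_ofReal ?_
  rw [mean, div_right_comm]
  refine div_le_div_of_nonneg_right ?_ hc.le
  rw [le_div_iff₀ (by positivity)]
  calc _ = ∑ n ∈ (Φ N).filter (fun n => n ∈ {n | ε < ‖c n‖}), ε ^ 2 := by simp
    _ ≤ ∑ n ∈ (Φ N).filter (fun n => n ∈ {n | ε < ‖c n‖}), ‖c n‖ ^ 2 := by
        refine Finset.sum_le_sum fun n hn => ?_
        have : ε < ‖c n‖ := (Finset.mem_filter.1 hn).2
        gcongr
    _ ≤ _ := Finset.sum_le_sum_of_subset_of_nonneg (Finset.filter_subset _ _)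
        fun _ _ _ => sq_nonneg _

end Seminorm

/-! ### Truncations -/

section Truncation

/-- The truncation of `f` at height `M`. -/
noncomputable def truncation (M : ℕ) (f : ℕ+ → ℂ) : boundedFunctions :=
  ⟨fun n => if ‖f n‖ ≤ M then f n else 0, M, fun n => by
    beta_reduce
    split_ifs with h
    · exact h
    · simp⟩

theorem norm_truncation_le (M : ℕ) (f : ℕ+ → ℂ) (n : ℕ+) : ‖(truncation M f).1 n‖ ≤ M := by
  simp only [truncation]
  split_ifs with h
  · exact h
  · simp

theorem norm_truncation_le_norm (M : ℕ) (f : ℕ+ → ℂ) (n : ℕ+) :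
    ‖(truncation M f).1 n‖ ≤ ‖f n‖ := by
  simp only [truncation]
  split_ifs with h
  · exact le_rfl
  · simp

/-- Gives smallness of the tail in mean, not in mean square; this suffices for weak mixing, which
tests against bounded functions only. -/
theorem mul_norm_sub_truncation_le (M : ℕ) (f : ℕ+ → ℂ) (n : ℕ+) :
    M * ‖f n - (truncation M f).1 n‖ ≤ ‖f n‖ ^ 2 := by
  simp only [truncation]
  split_ifs with h
  · simp
  · rw [sub_zero, sq]
    gcongr
    exact (not_le.1 h).le

/-- Large values are set to zero rather than clipped, so the difference and the smaller truncation
have disjoint supports and Pythagoras holds pointwise. -/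
theorem sq_norm_truncation_sub {M N : ℕ} (h : M ≤ N) (f : ℕ+ → ℂ) (n : ℕ+) :
    ‖(truncation N f - truncation M f).1 n‖ ^ 2
      = ‖(truncation N f).1 n‖ ^ 2 - ‖(truncation M f).1 n‖ ^ 2 := by
  have hMN : (M : ℝ) ≤ N := by exact_mod_cast h
  change ‖(truncation N f).1 n - (truncation M f).1 n‖ ^ 2 = _
  simp only [truncation]
  split_ifs with h1 h2 h2
  · simp
  · simp
  · exact absurd (h2.trans hMN) h1
  · simp

end Truncation

/-! ### Functions as vectors; clamping -/

section Realisation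

variable {H : Type} [NormedAddCommGroup H] [InnerProductSpace ℂ H]
  {ι : boundedFunctions →ₗ[ℂ] H} {Φ : ℕ → Finset ℕ+} {𝒰 : Ultrafilter ℕ}

theorem tendsto_mean_sq_norm (hι : ∀ f g : boundedFunctions, Tendsto
      (fun N => cmean (Φ N) fun n => (starRingEnd ℂ) (f.1 n) * g.1 n) 𝒰 (𝓝 (inner ℂ (ι f) (ι g))))
    (f : boundedFunctions) :
    Tendsto (fun N => mean (Φ N) fun n => ‖f.1 n‖ ^ 2) 𝒰 (𝓝 (‖ι f‖ ^ 2)) := by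
  have h := (Complex.continuous_re.tendsto _).comp (hι f f)
  simp only [Function.comp_def, ← Complex.normSq_eq_conj_mul_self, Complex.normSq_eq_norm_sq,
    cmean_ofReal, Complex.ofReal_re, inner_self_eq_norm_sq_to_K] at h
  convert h using 2
  norm_cast

/-- Through this, pointwise Lipschitz maps act as Lipschitz maps on the image of `ι`. -/
theorem norm_le_of_norm_apply_le (hι : ∀ f g : boundedFunctions, Tendsto
      (fun N => cmean (Φ N) fun n => (starRingEnd ℂ) (f.1 n) * g.1 n) 𝒰 (𝓝 (inner ℂ (ι f) (ι g))))
    {f g : boundedFunctions} (h : ∀ n, ‖f.1 n‖ ≤ ‖g.1 n‖) : ‖ι f‖ ≤ ‖ι g‖ := by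
  refine (sq_le_sq₀ (norm_nonneg _) (norm_nonneg _)).1 ?_
  refine le_of_tendsto_of_tendsto' (tendsto_mean_sq_norm hι f) (tendsto_mean_sq_norm hι g)
    fun N => mean_mono fun n _ => ?_
  gcongr
  exact h n

theorem boundedShift_pow_apply (m : ℕ) (f : boundedFunctions) :
    ((boundedShift ^ m) f).1 = natShift m f.1 := by
  induction m with
  | zero => rfl
  | succ m ih =>
    rw [add_comm, pow_add, pow_one, Module.End.mul_apply, ← natShift_natShift, ← ih]
    rfl

theorem pow_apply_eq {U : H →ₗᵢ[ℂ] H} (hU : ∀ f, U (ι f) = ι (boundedShift f)) (m : ℕ)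
    (f : boundedFunctions) : (U ^ m) (ι f) = ι ((boundedShift ^ m) f) := by
  induction m with
  | zero => rfl
  | succ m ih =>
    rw [add_comm, U.pow_add_apply, ih, pow_one, hU, pow_add, pow_one, Module.End.mul_apply]

/-- The truncations of an `L²` function form a Cauchy sequence. -/
theorem cauchySeq_truncation (hι : ∀ f g : boundedFunctions, Tendsto
      (fun N => cmean (Φ N) fun n => (starRingEnd ℂ) (f.1 n) * g.1 n) 𝒰 (𝓝 (inner ℂ (ι f) (ι g))))
    (h𝒰 : (𝒰 : Filter ℕ) ≤ atTop) {f : ℕ+ → ℂ} {C : ℝ}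
    (hf : ∀ᶠ N in atTop, mean (Φ N) (fun n => ‖f n‖ ^ 2) ≤ C) :
    CauchySeq fun M => ι (truncation M f) := by
  have hle : ∀ M, ‖ι (truncation M f)‖ ^ 2 ≤ C := fun M => by
    refine le_of_tendsto (tendsto_mean_sq_norm hι _) ((hf.filter_mono h𝒰).mono fun N hN => le_trans ?_ hN)
    refine mean_mono fun n _ => ?_
    gcongr
    exact norm_truncation_le_norm M f n
  have hsub : ∀ M N, M ≤ N → ‖ι (truncation N f) - ι (truncation M f)‖ ^ 2
      = ‖ι (truncation N f)‖ ^ 2 - ‖ι (truncation M f)‖ ^ 2 := fun M N h => by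
    rw [← map_sub]
    refine tendsto_nhds_unique (tendsto_mean_sq_norm hι _)
      (((tendsto_mean_sq_norm hι _).sub (tendsto_mean_sq_norm hι _)).congr fun k => ?_)
    simp only [sq_norm_truncation_sub h, mean, Finset.sum_sub_distrib, sub_div]
  have hmono : Monotone fun M => ‖ι (truncation M f)‖ ^ 2 := fun M N h => by
    have := hsub M N h
    have h2 := sq_nonneg ‖ι (truncation N f) - ι (truncation M f)‖
    simp only
    linarith
  have hcau : CauchySeq fun M => ‖ι (truncation M f)‖ ^ 2 :=
    (tendsto_atTop_ciSup hmono ⟨C, by rintro _ ⟨M, rfl⟩; exact hle M⟩).cauchySeq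
  rw [Metric.cauchySeq_iff] at hcau ⊢
  intro ε hε
  obtain ⟨K, hK⟩ := hcau (ε ^ 2) (by positivity)
  refine ⟨K, fun m hm n hn => ?_⟩
  have h1 := hK m hm n hn
  refine (sq_lt_sq₀ dist_nonneg hε.le).1 (lt_of_eq_of_lt ?_ h1)
  rcases le_total m n with h | h
  · rw [dist_comm, dist_eq_norm, hsub m n h, dist_comm, Real.dist_eq,
      abs_of_nonneg (sub_nonneg.2 (hmono h))]
  · rw [dist_eq_norm, hsub n m h, Real.dist_eq, abs_of_nonneg (sub_nonneg.2 (hmono h))]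

/-- The truncation of the real part to an interval. -/
noncomputable def clampRe (a b : ℝ) (z : ℂ) : ℂ := ((max a (min b z.re) : ℝ) : ℂ)

theorem norm_clampRe_sub_le (a b : ℝ) (z w : ℂ) : ‖clampRe a b z - clampRe a b w‖ ≤ ‖z - w‖ := by
  rw [clampRe, clampRe, ← Complex.ofReal_sub, Complex.norm_real, Real.norm_eq_abs]
  calc |max a (min b z.re) - max a (min b w.re)| ≤ |min b z.re - min b w.re| := by
        rw [max_comm a, max_comm a]
        exact abs_max_sub_max_le_abs _ _ _
    _ ≤ |z.re - w.re| := by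
        have := abs_min_sub_min_le_max b z.re b w.re
        simpa using this
    _ ≤ ‖z - w‖ := by rw [← Complex.sub_re]; exact Complex.abs_re_le_norm _

theorem clampRe_eq_self {a b x : ℝ} (h1 : a ≤ x) (h2 : x ≤ b) : clampRe a b x = x := by
  rw [clampRe, Complex.ofReal_re, min_eq_right h2, max_eq_right h1]

/-- Pointwise application of `clampRe` to a bounded function. -/
noncomputable def boundedClamp (a b : ℝ) (f : boundedFunctions) : boundedFunctions :=
  ⟨fun n => clampRe a b (f.1 n), by
    obtain ⟨C, hC⟩ := f.2
    refine ⟨C + ‖clampRe a b 0‖, fun n => ?_⟩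
    have h := norm_clampRe_sub_le a b (f.1 n) 0
    rw [sub_zero] at h
    calc ‖clampRe a b (f.1 n)‖ = ‖(clampRe a b (f.1 n) - clampRe a b 0) + clampRe a b 0‖ := by
          rw [sub_add_cancel]
      _ ≤ _ := (norm_add_le _ _).trans (by gcongr; exact h.trans (hC n))⟩

theorem valuesIn_boundedClamp {a b : ℝ} (hab : a ≤ b) (f : boundedFunctions) :
    ValuesIn (boundedClamp a b f).1 a b := fun _ =>
  ⟨_, rfl, le_max_left _ _, max_le hab (min_le_left _ _)⟩

/-- The infimum and supremum of `f` give one interval to clamp to that serves all admissible bounds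
at once. -/
theorem ValuesIn.exists_sharp {f : ℕ+ → ℂ} {a b : ℝ} (hf : ValuesIn f a b) :
    ∃ a' b', a' ≤ b' ∧ ValuesIn f a' b' ∧ ∀ c d, ValuesIn f c d → c ≤ a' ∧ b' ≤ d := by
  have key : ∀ c d, ValuesIn f c d → ∀ n, c ≤ (f n).re ∧ (f n).re ≤ d := fun c d h n => by
    obtain ⟨x, hx, h1, h2⟩ := h n
    rw [hx, Complex.ofReal_re]
    exact ⟨h1, h2⟩
  have hbelow : BddBelow (Set.range fun n => (f n).re) :=
    ⟨a, by rintro _ ⟨n, rfl⟩; exact (key a b hf n).1⟩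
  have habove : BddAbove (Set.range fun n => (f n).re) :=
    ⟨b, by rintro _ ⟨n, rfl⟩; exact (key a b hf n).2⟩
  refine ⟨⨅ n, (f n).re, ⨆ n, (f n).re, (ciInf_le hbelow 1).trans (le_ciSup habove 1), fun n => ?_,
    fun c d h => ⟨le_ciInf fun n => (key c d h n).1, ciSup_le fun n => (key c d h n).2⟩⟩
  obtain ⟨x, hx, -⟩ := hf n
  refine ⟨x, hx, ?_, ?_⟩
  · have := ciInf_le hbelow n
    rwa [hx, Complex.ofReal_re] at this
  · have := le_ciSup habove n
    rwa [hx, Complex.ofReal_re] at this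

/-- If `f` is real-valued in `[a, b]`, clamping an approximation of the projection of `f` to the
compact vectors yields another such approximation. -/
theorem tendsto_boundedClamp [CompleteSpace H] {U : H →ₗᵢ[ℂ] H}
    (hι : ∀ f g : boundedFunctions, Tendsto
      (fun N => cmean (Φ N) fun n => (starRingEnd ℂ) (f.1 n) * g.1 n) 𝒰 (𝓝 (inner ℂ (ι f) (ι g))))
    (hU : ∀ f, U (ι f) = ι (boundedShift f)) {f : boundedFunctions} {a b : ℝ}
    (hf : ValuesIn f.1 a b) {z : H} (hz : z ∈ compactVectors U)
    (hperp : ι f - z ∈ (compactVectors U)ᗮ) {u : ℕ → boundedFunctions}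
    (hu : Tendsto (fun N => ι (u N)) atTop (𝓝 z)) :
    Tendsto (fun N => ι (boundedClamp a b (u N))) atTop (𝓝 z) := by
  have hlip : ∀ g g' : boundedFunctions,
      ‖ι (boundedClamp a b g) - ι (boundedClamp a b g')‖ ≤ ‖ι g - ι g'‖ := fun g g' => by
    rw [← map_sub, ← map_sub]
    exact norm_le_of_norm_apply_le hι fun n => norm_clampRe_sub_le _ _ _ _
  have hcau : CauchySeq fun N => ι (boundedClamp a b (u N)) := by
    have h := hu.cauchySeq
    rw [Metric.cauchySeq_iff] at h ⊢
    intro ε hε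
    obtain ⟨K, hK⟩ := h ε hε
    refine ⟨K, fun m hm n hn => lt_of_le_of_lt ?_ (hK m hm n hn)⟩
    rw [dist_eq_norm, dist_eq_norm]
    exact hlip _ _
  obtain ⟨y, hy⟩ := cauchySeq_tendsto_of_complete hcau
  -- Clamping commutes with the shift and is 1-Lipschitz, so the orbit of `y` varies no more than
  -- that of `z`.
  have hymem : y ∈ compactVectors U := by
    refine PrecompactSeq.of_dist_le hz fun m k => ?_
    rw [dist_eq_norm, dist_eq_norm]
    have e : ∀ (w : ℕ → boundedFunctions) (w' : H), Tendsto (fun N => ι (w N)) atTop (𝓝 w') →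
        Tendsto (fun N => ‖ι ((boundedShift ^ m) (w N) - (boundedShift ^ k) (w N))‖) atTop
          (𝓝 ‖(U ^ m) w' - (U ^ k) w'‖) := fun w w' h => by
      simp only [map_sub ι, ← pow_apply_eq hU]
      exact ((((U ^ m).continuous.tendsto _).comp h).sub
        (((U ^ k).continuous.tendsto _).comp h)).norm
    refine le_of_tendsto_of_tendsto' (e _ _ hy) (e _ _ hu) fun N =>
      norm_le_of_norm_apply_le hι fun n => ?_
    simp only [Submodule.coe_sub, Pi.sub_apply, boundedShift_pow_apply]
    exact norm_clampRe_sub_le _ _ _ _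
  have hfix : boundedClamp a b f = f := by
    ext n
    obtain ⟨x, hx, h1, h2⟩ := hf n
    simp only [boundedClamp, hx, clampRe_eq_self h1 h2]
  -- Clamping fixes `f`, so `y` is a compact vector at least as close to it as its projection `z`;
  -- hence `y = z`.
  have hle : ‖ι f - y‖ ≤ ‖ι f - z‖ := by
    refine le_of_tendsto_of_tendsto' (hy.const_sub (ι f)).norm (hu.const_sub (ι f)).norm fun N => ?_
    have := hlip f (u N)
    rwa [hfix] at this
  have hpyth := norm_add_sq_eq_norm_sq_add_norm_sq_of_inner_eq_zero (𝕜 := ℂ) (ι f - z) (z - y)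
    ((Submodule.mem_orthogonal' _ _).1 hperp _ (Submodule.sub_mem _ hz hymem))
  rw [sub_add_sub_cancel] at hpyth
  have hzy : z - y = 0 := by
    rw [← norm_eq_zero]
    nlinarith [norm_nonneg (ι f - y), norm_nonneg (z - y), norm_nonneg (ι f - z)]
  rwa [sub_eq_zero.1 hzy]

end Realisation

/-! ### Choosing the subsequence by stages -/

/-- A subsequence chosen by stages. The stage function `j` sends every integer to the first stage at
which it is seen; the integers of stages before the `N`-th have small `W N`-mass compared to the
size of the `N`-th set. -/
theorem exists_subsequence_stages {Φ : ℕ → Finset ℕ+} (hΦ : IsFolnerSeq Φ) {𝒰 : Ultrafilter ℕ}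
    (h𝒰 : (𝒰 : Filter ℕ) ≤ atTop) {P : ℕ → ℕ → Prop} (hP : ∀ N, ∀ᶠ k in 𝒰, P N k)
    {W : ℕ → ℕ+ → ℝ} (hW : ∀ N q, 0 ≤ W N q) :
    ∃ (φ : ℕ → ℕ) (j : ℕ+ → ℕ), StrictMono φ ∧ (∀ N, P N (φ N)) ∧
      (∀ N, ∀ n ∈ Φ (φ N), ∀ m ≤ N, j (natAdd n m) ≤ N) ∧
      ∀ N (s : Finset ℕ+), (∀ q ∈ s, j q < N) → ∑ q ∈ s, W N q ≤ (Φ (φ N)).card / (N + 1) := by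
  classical
  -- A crude monotone bound for all `n + m` with `n ∈ Φ k` and `m ≤ k`; the summand `i` also makes
  -- `b k ≥ k`, so every integer gets a stage.
  let b : ℕ → ℕ := fun k => ∑ i ∈ Finset.range (k + 1), (∑ n ∈ Φ i, (n : ℕ) + i)
  have hb_mono : Monotone b := fun k l h =>
    Finset.sum_le_sum_of_subset (Finset.range_mono (Nat.succ_le_succ h))
  have hb_last : ∀ k, ∑ n ∈ Φ k, (n : ℕ) + k ≤ b k := fun k =>
    Finset.single_le_sum (f := fun i => ∑ n ∈ Φ i, (n : ℕ) + i) (fun _ _ => Nat.zero_le _)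
      (Finset.self_mem_range_succ k)
  have hb_add : ∀ k, ∀ n ∈ Φ k, ∀ m ≤ k, (n : ℕ) + m ≤ b k := fun k n hn m hm =>
    (add_le_add (Finset.single_le_sum (f := fun n : ℕ+ => (n : ℕ)) (fun _ _ => Nat.zero_le _) hn)
      hm).trans (hb_last k)
  let D : ℕ → Finset ℕ+ := fun k => (Finset.range (b k)).image Nat.succPNat
  have hD : ∀ k (q : ℕ+), (q : ℕ) ≤ b k → q ∈ D k := fun k q h =>
    Finset.mem_image.2 ⟨q.natPred, Finset.mem_range.2 (by
      have := q.natPred_add_one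
      omega), q.succPNat_natPred⟩
  have hnext : ∀ N k, ∃ k', k < k' ∧ P N k' ∧
      ∑ q ∈ D k, W N q ≤ (Φ k').card / ((N : ℝ) + 1) := fun N k => by
    have h1 : ∀ᶠ k' in (𝒰 : Filter ℕ), k < k' := (eventually_gt_atTop k).filter_mono h𝒰
    have h2 : ∀ᶠ k' in (𝒰 : Filter ℕ), (∑ q ∈ D k, W N q) * (N + 1) ≤ (Φ k').card :=
      (hΦ.tendsto_card.eventually_ge_atTop _).filter_mono h𝒰
    obtain ⟨k', hk1, hk2, hk3⟩ := (h1.and ((hP N).and h2)).exists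
    exact ⟨k', hk1, hk2, (le_div_iff₀ (by positivity)).2 hk3⟩
  choose next hn1 hn2 hn3 using hnext
  let φ : ℕ → ℕ := fun N => Nat.rec (next 0 0) (fun N k => next (N + 1) k) N
  have hφ : StrictMono φ := strictMono_nat_of_lt_succ fun N => hn1 (N + 1) (φ N)
  have hex : ∀ q : ℕ+, ∃ N, (q : ℕ) ≤ b (φ N) := fun q =>
    ⟨q, (hφ.le_apply).trans ((Nat.le_add_left _ _).trans (hb_last _))⟩
  refine ⟨φ, fun q => Nat.find (hex q), hφ, fun N => ?_, fun N n hn m hm => ?_, fun N s hs => ?_⟩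
  · cases N with
    | zero => exact hn2 0 0
    | succ N => exact hn2 (N + 1) (φ N)
  · exact Nat.find_min' _ (hb_add _ n hn m (hm.trans hφ.le_apply))
  · cases N with
    | zero =>
      rw [Finset.eq_empty_of_forall_notMem fun q hq => absurd (hs q hq) (Nat.not_lt_zero _)]
      rw [Finset.sum_empty]
      positivity
    | succ N =>
      have hsub : s ⊆ D (φ N) := fun q hq => hD _ q
        ((Nat.find_spec (hex q)).trans (hb_mono (hφ.monotone (Nat.lt_succ_iff.1 (hs q hq)))))
      exact (Finset.sum_le_sum_of_subset_of_nonneg hsub fun q _ _ => hW _ q).trans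
        (hn3 (N + 1) (φ N))

/-- Along a subsequence chosen by stages, a function dominated by `W N` at earlier stages and by `V`
at the `N`-th one has average at most that of `V`, up to `1 / (N + 1)`. -/
theorem mean_natAdd_le_of_stages {S : Finset ℕ+} {j : ℕ+ → ℕ} {N m : ℕ} (hm : m ≤ N)
    (hj : ∀ n ∈ S, ∀ m ≤ N, j (natAdd n m) ≤ N) {W G V : ℕ+ → ℝ}
    (hW : ∀ s : Finset ℕ+, (∀ q ∈ s, j q < N) → ∑ q ∈ s, W q ≤ (S.card : ℝ) / (N + 1))
    (hS : S.Nonempty) (hV : ∀ q, 0 ≤ V q) (h1 : ∀ q, j q < N → G q ≤ W q)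
    (h2 : ∀ q, j q = N → G q ≤ V q) :
    mean S (fun n => G (natAdd n m)) ≤ 1 / (N + 1) + mean S fun n => V (natAdd n m) := by
  classical
  have hc : (0 : ℝ) < S.card := by exact_mod_cast hS.card_pos
  have key : ∑ n ∈ S, G (natAdd n m) ≤ (S.card : ℝ) / (N + 1) + ∑ n ∈ S, V (natAdd n m) := by
    rw [← Finset.sum_filter_add_sum_filter_not S fun n => j (natAdd n m) < N]
    refine add_le_add ?_ ?_
    · calc ∑ n ∈ S.filter (fun n => j (natAdd n m) < N), G (natAdd n m)
          ≤ ∑ n ∈ S.filter (fun n => j (natAdd n m) < N), W (natAdd n m) :=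
            Finset.sum_le_sum fun n hn => h1 _ (Finset.mem_filter.1 hn).2
        _ = ∑ q ∈ (S.filter (fun n => j (natAdd n m) < N)).image (fun n => natAdd n m), W q := by
            rw [Finset.sum_image fun _ _ _ _ h => natAdd_injective m h]
        _ ≤ _ := hW _ fun q hq => by
            obtain ⟨n, hn, rfl⟩ := Finset.mem_image.1 hq
            exact (Finset.mem_filter.1 hn).2
    · refine (Finset.sum_le_sum fun n hn => ?_).trans
        (Finset.sum_le_sum_of_subset_of_nonneg (Finset.filter_subset _ _) fun n _ _ => hV _)
      obtain ⟨hn1, hn2⟩ := Finset.mem_filter.1 hn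
      exact h2 _ (le_antisymm (hj n hn1 m hm) (not_lt.1 hn2))
  rw [mean, mean, div_le_iff₀ hc, add_mul, div_mul_cancel₀ _ hc.ne', one_div_mul_eq_div]
  exact key

/-- Points leaving $\Phi_N$ inject into the symmetric difference. The Følner condition speaks of
positive translations only, hence the separate case `m = 0`. -/
theorem IsFolnerSeq.tendsto_card_filter {Φ : ℕ → Finset ℕ+} (hΦ : IsFolnerSeq Φ) (m : ℕ) :
    Tendsto (fun N => (((Φ N).filter fun n => natAdd n m ∉ Φ N).card : ℝ) / (Φ N).card) atTop
      (𝓝 0) := by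
  rcases Nat.eq_zero_or_pos m with rfl | hm
  · have : ∀ N, (Φ N).filter (fun n => natAdd n 0 ∉ Φ N) = ∅ := fun N =>
      Finset.filter_eq_empty_iff.2 fun n hn => not_not.2 hn
    simp only [this, Finset.card_empty, Nat.cast_zero, zero_div]
    exact tendsto_const_nhds
  · refine squeeze_zero (fun N => by positivity) (fun N => ?_) (hΦ.tendsto ⟨m, hm⟩)
    refine div_le_div_of_nonneg_right ?_ (Nat.cast_nonneg _)
    rw [← Finset.card_image_of_injective _ (natAdd_injective m)]
    refine Nat.cast_le.2 (Finset.card_le_card fun q hq => ?_)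
    obtain ⟨n, hn, rfl⟩ := Finset.mem_image.1 hq
    obtain ⟨hn1, hn2⟩ := Finset.mem_filter.1 hn
    exact Finset.mem_symmDiff.2 (Or.inl ⟨Finset.mem_image.2 ⟨n, hn1, rfl⟩, hn2⟩)

/-! ### Transfer of correlations -/

section Correlations

variable {H : Type} [NormedAddCommGroup H] [InnerProductSpace ℂ H]
  {ι : boundedFunctions →ₗ[ℂ] H} {U : H →ₗᵢ[ℂ] H}

/-- The correlations of the first `N` shifts of `u` over `S` are within `1 / (N + 1)` of the ones in
the Hilbert space. -/
def CorrelationsClose (ι : boundedFunctions →ₗ[ℂ] H) (U : H →ₗᵢ[ℂ] H) (N : ℕ) (S : Finset ℕ+)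
    (u : boundedFunctions) : Prop :=
  ∀ n ≤ N, ∀ m ≤ N, ‖cmean S (fun p => (starRingEnd ℂ) (natShift n u.1 p) * natShift m u.1 p)
    - inner ℂ ((U ^ n) (ι u)) ((U ^ m) (ι u))‖ ≤ 1 / (N + 1)

theorem eventually_correlationsClose {Φ : ℕ → Finset ℕ+} {𝒰 : Ultrafilter ℕ}
    (hι : ∀ f g : boundedFunctions, Tendsto
      (fun N => cmean (Φ N) fun n => (starRingEnd ℂ) (f.1 n) * g.1 n) 𝒰 (𝓝 (inner ℂ (ι f) (ι g))))
    (hU : ∀ f, U (ι f) = ι (boundedShift f)) (N : ℕ) (u : boundedFunctions) :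
    ∀ᶠ k in 𝒰, CorrelationsClose ι U N (Φ k) u := by
  refine (eventually_all_finite (Set.finite_Iic N)).2 fun n _ =>
    (eventually_all_finite (Set.finite_Iic N)).2 fun m _ => ?_
  have h := hι ((boundedShift ^ n) u) ((boundedShift ^ m) u)
  simp only [boundedShift_pow_apply, ← pow_apply_eq hU] at h
  filter_upwards [Metric.tendsto_nhds.1 h (1 / (N + 1)) (by positivity)] with k hk
  rw [dist_eq_norm] at hk
  exact hk.le

/-- Expanding the square leaves finitely many correlations, all controlled once `N` exceeds the
exponents. -/
theorem tendsto_mean_sq_norm_sum {Ψ : ℕ → Finset ℕ+} {u : ℕ → boundedFunctions} {w : H}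
    (hu : Tendsto (fun N => ι (u N)) atTop (𝓝 w))
    (hcor : ∀ N, CorrelationsClose ι U N (Ψ N) (u N)) {κ : Type*} (s : Finset κ) (e : κ → ℕ)
    (a : κ → ℂ) :
    Tendsto (fun N => mean (Ψ N) fun p => ‖∑ i ∈ s, a i * natShift (e i) (u N).1 p‖ ^ 2) atTop
      (𝓝 (‖∑ i ∈ s, a i • (U ^ e i) w‖ ^ 2)) := by
  have hlim : ∀ n m, Tendsto (fun N => cmean (Ψ N) fun p =>
      (starRingEnd ℂ) (natShift n (u N).1 p) * natShift m (u N).1 p) atTop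
      (𝓝 (inner ℂ ((U ^ n) w) ((U ^ m) w))) := fun n m => by
    have h1 : Tendsto (fun N => inner ℂ ((U ^ n) (ι (u N))) ((U ^ m) (ι (u N)))) atTop
        (𝓝 (inner ℂ ((U ^ n) w) ((U ^ m) w))) :=
      (((U ^ n).continuous.tendsto _).comp hu).inner (((U ^ m).continuous.tendsto _).comp hu)
    have h2 : Tendsto (fun N => cmean (Ψ N) (fun p =>
        (starRingEnd ℂ) (natShift n (u N).1 p) * natShift m (u N).1 p)
        - inner ℂ ((U ^ n) (ι (u N))) ((U ^ m) (ι (u N)))) atTop (𝓝 0) := by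
      refine squeeze_zero_norm' ?_ tendsto_one_div_add_atTop_nhds_zero_nat
      filter_upwards [eventually_ge_atTop n, eventually_ge_atTop m] with N hn hm
      exact hcor N n hn m hm
    simpa using h2.add h1
  have hsum := tendsto_finsetSum s fun i _ => tendsto_finsetSum s fun k _ =>
    (hlim (e i) (e k)).const_mul ((starRingEnd ℂ) (a i) * a k)
  have hre := (Complex.continuous_re.tendsto _).comp hsum
  have e1 : (∑ i ∈ s, ∑ k ∈ s, (starRingEnd ℂ) (a i) * a k *
      inner ℂ ((U ^ e i) w) ((U ^ e k) w)).re = ‖∑ i ∈ s, a i • (U ^ e i) w‖ ^ 2 := by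
    rw [← @inner_self_eq_norm_sq ℂ, sum_inner]
    simp only [inner_sum, inner_smul_left, inner_smul_right]
    refine congrArg Complex.re
      (Finset.sum_congr rfl fun i _ => Finset.sum_congr rfl fun k _ => ?_)
    ring
  rw [e1] at hre
  refine hre.congr fun N => ?_
  have e2 : ∑ i ∈ s, ∑ k ∈ s, (starRingEnd ℂ) (a i) * a k * cmean (Ψ N) (fun p =>
      (starRingEnd ℂ) (natShift (e i) (u N).1 p) * natShift (e k) (u N).1 p)
      = (mean (Ψ N) (fun p => ‖∑ i ∈ s, a i * natShift (e i) (u N).1 p‖ ^ 2) : ℝ) := by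
    simp only [← smul_eq_mul (_ * _ : ℂ), ← cmean_smul]
    simp only [← cmean_finset_sum, ← cmean_ofReal]
    congr 1
    ext p
    rw [← Complex.normSq_eq_norm_sq, Complex.normSq_eq_conj_mul_self, map_sum, Finset.sum_mul_sum]
    refine Finset.sum_congr rfl fun i _ => Finset.sum_congr rfl fun k _ => ?_
    rw [map_mul, smul_eq_mul]
    ring
  simp only [Function.comp, e2, Complex.ofReal_re]

end Correlations

theorem hasInner_iff {Ψ : ℕ → Finset ℕ+} {f h : ℕ+ → ℂ} {c : ℂ} :
    HasInner Ψ f h c ↔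
      Tendsto (fun N => cmean (Ψ N) fun n => f n * (starRingEnd ℂ) (h n)) atTop (𝓝 c) := by
  simp only [HasInner, cmean, smul_eq_mul, div_eq_inv_mul]

/-! ### Compactness and weak mixing along the subsequence -/

section Along

variable {H : Type} [NormedAddCommGroup H] [InnerProductSpace ℂ H]
  {ι : boundedFunctions →ₗ[ℂ] H} {U : H →ₗᵢ[ℂ] H} {Ψ : ℕ → Finset ℕ+}
  {u : ℕ → boundedFunctions} {w : H} {F : ℕ+ → ℂ}

/-- A function approximated along `Ψ` by bounded functions converging to `w` has the mean square of
`w`. -/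
theorem eventually_mean_sq_norm_le (hu : Tendsto (fun N => ι (u N)) atTop (𝓝 w))
    (hcor : ∀ N, CorrelationsClose ι U N (Ψ N) (u N))
    (hF : Tendsto (fun N => mean (Ψ N) fun p => ‖F p - (u N).1 p‖ ^ 2) atTop (𝓝 0)) :
    ∃ C, ∀ᶠ N in atTop, mean (Ψ N) (fun p => ‖F p‖ ^ 2) ≤ C := by
  have h1 := tendsto_mean_sq_norm_sum hu hcor {()} (fun _ => 0) (fun _ => 1)
  simp only [Finset.sum_singleton, one_mul, natShift_zero] at h1
  have h2 := (hF.const_mul 2).add (h1.const_mul 2)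
  refine ⟨_, (h2.eventually_lt_const (lt_add_one _)).mono fun N hN => le_trans ?_ hN.le⟩
  have := mean_sq_norm_add_le (Ψ N) (fun p => F p - (u N).1 p) (u N).1
  simpa only [sub_add_cancel] using this

theorem isCompactAlong_of_approx (hΨ : ∀ N, (Ψ N).Nonempty) (hw : w ∈ compactVectors U)
    (hu : Tendsto (fun N => ι (u N)) atTop (𝓝 w))
    (hcor : ∀ N, CorrelationsClose ι U N (Ψ N) (u N))
    (hF : ∀ m, Tendsto (fun N => mean (Ψ N) fun p => ‖natShift m F p - natShift m (u N).1 p‖ ^ 2)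
      atTop (𝓝 0)) : IsCompactAlong Ψ F := by
  intro ε hε
  obtain ⟨K, hK⟩ := PrecompactSeq.exists_bound hw (half_pos hε)
  -- Orbits are indexed from 0 and shifts from 1; the isometry absorbs the offset.
  refine ⟨K.succPNat, fun m => ?_⟩
  obtain ⟨k, hk, hd⟩ := hK m.natPred
  refine ⟨k.succPNat, Nat.succPNat_le_succPNat.2 hk, ?_⟩
  have hd' : ‖(U ^ (m : ℕ)) w - (U ^ (k.succPNat : ℕ)) w‖ < ε / 2 := by
    rw [← m.natPred_add_one, Nat.succPNat_coe, Nat.succ_eq_add_one, add_comm _ 1, add_comm _ 1,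
      U.pow_add_apply, U.pow_add_apply, ← dist_eq_norm, LinearIsometry.dist_map]
    exact hd
  set k' := k.succPNat
  have h1 := tendsto_mean_sq_norm_sum hu hcor Finset.univ ![(m : ℕ), (k' : ℕ)] ![1, -1]
  simp only [Fin.sum_univ_two, Matrix.cons_val_zero, Matrix.cons_val_one, one_mul, one_smul,
    neg_one_mul, neg_one_smul, ← sub_eq_add_neg] at h1
  have h2 := ((((hF m).const_mul 2).add ((hF k').const_mul 2)).const_mul 2).add (h1.const_mul 2)
  -- The limit is below $2(\varepsilon/2)^2=\varepsilon^2/2$, and $(4/5)^2>1/2$ leaves room for the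
  -- strict inequality.
  have hlt : 2 * (2 * 0 + 2 * 0) + 2 * ‖(U ^ (m : ℕ)) w - (U ^ (k' : ℕ)) w‖ ^ 2 < (4 / 5 * ε) ^ 2 := by
    have := norm_nonneg ((U ^ (m : ℕ)) w - (U ^ (k' : ℕ)) w)
    nlinarith
  refine (besSeminorm_le hΨ (r := 4 / 5 * ε) (by positivity)
    ((h2.eventually_lt_const hlt).mono fun N hN => le_trans ?_ hN.le)).trans_lt
      ((ENNReal.ofReal_lt_ofReal_iff hε).2 (by linarith))
  have e : (shift m F - shift k' F) = fun p =>
      ((natShift m F p - natShift m (u N).1 p) - (natShift k' F p - natShift k' (u N).1 p))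
        + (natShift m (u N).1 p - natShift k' (u N).1 p) := by
    ext p
    simp only [Pi.sub_apply, shift_eq_natShift]
    ring
  rw [e]
  refine (mean_sq_norm_add_le _ _ _).trans ?_
  gcongr
  exact mean_sq_norm_sub_le _ _ _

/-- Combinations of the `c n` are bounded by those of the orbit of `w`, so a single vector `y`
represents every `c n`; weak mixing in $H$ along the given subsequence concludes. -/
theorem isWeakMixingAlong_of_approx [CompleteSpace H] (hΨ : IsFolnerSeq Ψ)
    (hw : w ∈ (compactVectors U)ᗮ) (hu : Tendsto (fun N => ι (u N)) atTop (𝓝 w))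
    (hcor : ∀ N, CorrelationsClose ι U N (Ψ N) (u N))
    (hF : ∀ m : ℕ+, Tendsto (fun N => mean (Ψ N) fun p =>
      ‖natShift m F p - natShift m (u N).1 p‖) atTop (𝓝 0)) : IsWeakMixingAlong Ψ F := by
  rintro h ⟨C, hC⟩ _ ⟨θ, hθ, rfl⟩ c hc ε hε
  have hC0 : 0 ≤ C := (norm_nonneg _).trans (hC 1)
  have hbound : ∀ (s : Finset ℕ+) (a : ℕ+ → ℂ),
      ‖∑ n ∈ s, a n * c n‖ ≤ C * ‖∑ n ∈ s, a n • (U ^ (n : ℕ)) w‖ := fun s a => by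
    have h1 := (tendsto_finsetSum s fun n _ => (hasInner_iff.1 (hc n)).const_mul (a n)).norm
    have h2 := (tendsto_mean_sq_norm_sum hu hcor s (fun n => (n : ℕ)) a).sqrt
    rw [Real.sqrt_sq (norm_nonneg _)] at h2
    have h3 := (((tendsto_finsetSum s fun n _ => (hF n).const_mul ‖a n‖).add h2).const_mul C).comp
      hθ.tendsto_atTop
    simp only [mul_zero, Finset.sum_const_zero, zero_add] at h3
    refine le_of_tendsto_of_tendsto' h1 h3 fun N => ?_
    set S := Ψ (θ N) with hS
    set v := u (θ N)
    have e1 : ∑ n ∈ s, a n * cmean ((Ψ ∘ θ) N) (fun p => shift n F p * (starRingEnd ℂ) (h p))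
        = cmean S fun p => (∑ n ∈ s, a n * natShift n F p) * (starRingEnd ℂ) (h p) := by
      simp only [← smul_eq_mul (a _), ← cmean_smul, ← cmean_finset_sum, Finset.sum_mul,
        smul_mul_assoc]
      rfl
    rw [e1]
    have e2 : ∀ p, ‖(∑ n ∈ s, a n * natShift n F p) * (starRingEnd ℂ) (h p)‖
        ≤ C * (∑ n ∈ s, ‖a n‖ * ‖natShift n F p - natShift n v.1 p‖
          + ‖∑ n ∈ s, a n * natShift n v.1 p‖) := fun p => by
      rw [norm_mul, RCLike.norm_conj, mul_comm]
      refine mul_le_mul (hC p) ?_ (norm_nonneg _) hC0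
      have : ∑ n ∈ s, a n * natShift n F p = ∑ n ∈ s, a n * (natShift n F p - natShift n v.1 p)
          + ∑ n ∈ s, a n * natShift n v.1 p := by
        rw [← Finset.sum_add_distrib]
        exact Finset.sum_congr rfl fun n _ => by ring
      rw [this]
      refine (norm_add_le _ _).trans (add_le_add_left (norm_sum_le_of_le s fun n _ => ?_) _)
      rw [norm_mul]
    refine (norm_cmean_le _ _).trans ((mean_mono fun p _ => e2 p).trans ?_)
    rw [mean_const_mul, mean_add, mean_finset_sum]
    simp only [mean_const_mul]
    refine mul_le_mul_of_nonneg_left (add_le_add_right ?_ _) hC0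
    exact Real.le_sqrt_of_sq_le (sq_mean_le _ _)
  obtain ⟨y, hy⟩ := exists_inner_eq_of_norm_sum_le _ c C hbound
  have hΨθ := hΨ.comp hθ
  refine upperDensity_eq_zero hΨθ.nonempty ?_ hε
  simp only [hy, norm_inner_symm y]
  exact tendsto_mean_sq_inner_of_mem_orthogonal hw hΨθ y

end Along

/-! ### Approximating the two components -/

section Decomposition

variable {H : Type} [NormedAddCommGroup H] [InnerProductSpace ℂ H]
  {ι : boundedFunctions →ₗ[ℂ] H} {Φ : ℕ → Finset ℕ+} {𝒰 : Ultrafilter ℕ}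

theorem eq_of_tendsto_truncation {f : boundedFunctions} {x : H}
    (hx : Tendsto (fun M => ι (truncation M f.1)) atTop (𝓝 x)) : x = ι f := by
  obtain ⟨C, hC⟩ := f.2
  refine tendsto_nhds_unique hx (tendsto_const_nhds.congr' ?_)
  filter_upwards [eventually_ge_atTop ⌈C⌉₊] with M hM
  congr 1
  ext n
  simp only [truncation]
  rw [if_pos ((hC n).trans ((Nat.le_ceil C).trans (Nat.cast_le.2 hM)))]

/-- Bounded approximations of the projection to the compact vectors that respect the bounds of a
real-valued `f`. -/
theorem exists_approx_projection [CompleteSpace H] {U : H →ₗᵢ[ℂ] H} (hd : DenseRange ι)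
    (hι : ∀ f g : boundedFunctions, Tendsto
      (fun N => cmean (Φ N) fun n => (starRingEnd ℂ) (f.1 n) * g.1 n) 𝒰 (𝓝 (inner ℂ (ι f) (ι g))))
    (hU : ∀ f, U (ι f) = ι (boundedShift f)) {f : ℕ+ → ℂ} {x z : H}
    (hx : Tendsto (fun M => ι (truncation M f)) atTop (𝓝 x)) (hz : z ∈ compactVectors U)
    (hperp : x - z ∈ (compactVectors U)ᗮ) :
    ∃ u : ℕ → boundedFunctions, Tendsto (fun N => ι (u N)) atTop (𝓝 z) ∧
      ∀ a b : ℝ, ValuesIn f a b → ∀ N, ValuesIn (u N).1 a b := by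
  have hex : ∀ N : ℕ, ∃ u, dist z (ι u) < 1 / ((N : ℝ) + 1) := fun N =>
    hd.exists_dist_lt z (by positivity)
  choose u hu using hex
  have hlim : Tendsto (fun N => ι (u N)) atTop (𝓝 z) := by
    rw [tendsto_iff_dist_tendsto_zero]
    refine squeeze_zero (fun _ => dist_nonneg) (fun N => ?_)
      tendsto_one_div_add_atTop_nhds_zero_nat
    rw [dist_comm]
    exact (hu N).le
  by_cases hv : ∃ a b, ValuesIn f a b
  · obtain ⟨a, b, hab⟩ := hv
    obtain ⟨a', b', hle, hf', hsharp⟩ := hab.exists_sharp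
    have hbdd : ∃ C : ℝ, ∀ n, ‖f n‖ ≤ C := ⟨max |a'| |b'|, fun n => by
      obtain ⟨r, hr, h1, h2⟩ := hf' n
      rw [hr, Complex.norm_real, Real.norm_eq_abs]
      exact abs_le_max_abs_abs h1 h2⟩
    let f₀ : boundedFunctions := ⟨f, hbdd⟩
    have hx0 : x = ι f₀ := eq_of_tendsto_truncation (f := f₀) hx
    refine ⟨fun N => boundedClamp a' b' (u N),
      tendsto_boundedClamp hι hU (f := f₀) hf' hz (hx0 ▸ hperp) hlim, fun c d hcd N n => ?_⟩
    obtain ⟨r, hr, h1, h2⟩ := valuesIn_boundedClamp hle (u N) n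
    obtain ⟨h3, h4⟩ := hsharp c d hcd
    exact ⟨r, hr, h3.trans h1, h2.trans h4⟩
  · exact ⟨u, hlim, fun a b h => absurd ⟨a, b, h⟩ hv⟩

/-- If all shifts of `f` are in `L²`, they are approximated in mean by those of the truncations. -/
theorem tendsto_mean_norm_sub_truncation {Ψ : ℕ → Finset ℕ+} {f : ℕ+ → ℂ} {m : ℕ} {C : ℝ}
    (hf : ∀ᶠ N in atTop, mean (Ψ N) (fun p => ‖natShift m f p‖ ^ 2) ≤ C) :
    Tendsto (fun N => mean (Ψ N) fun p => ‖natShift m f p - natShift m (truncation N f).1 p‖)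
      atTop (𝓝 0) := by
  have hlim : Tendsto (fun N : ℕ => C / N) atTop (𝓝 0) := tendsto_const_div_atTop_nhds_zero_nat C
  refine squeeze_zero' (Eventually.of_forall fun N => mean_nonneg fun _ _ => norm_nonneg _) ?_ hlim
  filter_upwards [hf, eventually_gt_atTop 0] with N hN hpos
  have hpos' : (0 : ℝ) < N := by exact_mod_cast hpos
  rw [le_div_iff₀ hpos', mul_comm, ← mean_const_mul]
  exact (mean_mono fun p _ => mul_norm_sub_truncation_le N f (natAdd p m)).trans hN

/-- Translation is injective and the indicator discards what leaves `S`. No control of `f` on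
translates of `S` is needed. -/
theorem mean_indicator_natAdd_le {S : Finset ℕ+} (m : ℕ) {v : ℕ+ → ℝ} (hv : ∀ q, 0 ≤ v q) :
    mean S (fun n => (S : Set ℕ+).indicator v (natAdd n m)) ≤ mean S v := by
  classical
  refine div_le_div_of_nonneg_right ?_ (Nat.cast_nonneg _)
  have hnn : ∀ q, 0 ≤ (S : Set ℕ+).indicator v q := fun q => Set.indicator_nonneg (fun q _ => hv q) q
  calc ∑ n ∈ S, (S : Set ℕ+).indicator v (natAdd n m)
      = ∑ q ∈ S.image (fun n => natAdd n m), (S : Set ℕ+).indicator v q := by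
        rw [Finset.sum_image fun _ _ _ _ h => natAdd_injective m h]
    _ ≤ ∑ q ∈ S.image (fun n => natAdd n m) ∪ S, (S : Set ℕ+).indicator v q :=
        Finset.sum_le_sum_of_subset_of_nonneg Finset.subset_union_left fun q _ _ => hnn q
    _ = ∑ q ∈ S, (S : Set ℕ+).indicator v q := by
        refine (Finset.sum_subset Finset.subset_union_right fun q _ hq => ?_).symm
        exact Set.indicator_of_notMem (by simpa using hq) _
    _ = ∑ q ∈ S, v q := Finset.sum_congr rfl fun q hq =>
        Set.indicator_of_mem (Finset.mem_coe.2 hq) _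

/-- Zeroing an `L²` function at the integers outside of the set of their own stage changes it by a
null function, and makes the truncations approximate all of its shifts. -/
theorem exists_regular_modification {Ψ : ℕ → Finset ℕ+} (hΨ : ∀ N, (Ψ N).Nonempty)
    {j : ℕ+ → ℕ} (hj : ∀ N, ∀ n ∈ Ψ N, ∀ m ≤ N, j (natAdd n m) ≤ N) {W : ℕ → ℕ+ → ℝ}
    (hW : ∀ N (s : Finset ℕ+), (∀ q ∈ s, j q < N) → ∑ q ∈ s, W N q ≤ ((Ψ N).card : ℝ) / (N + 1))
    (hbd : ∀ N, ∀ m ≤ N, N * ((((Ψ N).filter fun n => natAdd n m ∉ Ψ N).card : ℝ) / (Ψ N).card)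
      ≤ 1 / (N + 1)) {f : ℕ+ → ℂ} (hWf : ∀ N q, 2 * ‖f q‖ ≤ W N q)
    (hWf2 : ∀ N q, ‖f q‖ ^ 2 ≤ W N q) {C : ℝ}
    (hf : ∀ᶠ N in atTop, mean (Ψ N) (fun n => ‖f n‖ ^ 2) ≤ C) :
    ∃ f' : ℕ+ → ℂ, Tendsto (fun N => mean (Ψ N) fun n => ‖f n - f' n‖ ^ 2) atTop (𝓝 0) ∧
      ∀ m, Tendsto (fun N => mean (Ψ N) fun p =>
        ‖natShift m f' p - natShift m (truncation N f).1 p‖) atTop (𝓝 0) := by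
  classical
  let f' : ℕ+ → ℂ := fun q => if q ∈ Ψ (j q) then f q else 0
  have hf' : ∀ q, f' q = f q ∨ f' q = 0 := fun q => by
    simp only [f']
    split_ifs
    · exact Or.inl rfl
    · exact Or.inr rfl
  refine ⟨f', ?_, fun m => ?_⟩
  · refine squeeze_zero (fun N => mean_nonneg fun _ _ => sq_nonneg _) (fun N => ?_)
      tendsto_one_div_add_atTop_nhds_zero_nat
    have h := mean_natAdd_le_of_stages (m := 0) (Nat.zero_le N) (hj N) (hW N) (hΨ N)
      -- Points of `Ψ N` whose stage is `N` are kept, so only earlier stages contribute.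
      (G := fun q => ‖f q - f' q‖ ^ 2) (V := fun q => if q ∈ Ψ N then 0 else ‖f q‖ ^ 2)
      (fun q => by split_ifs <;> positivity) (fun q _ => ?_) (fun q hq => ?_)
    · refine h.trans_eq ?_
      have h0 : mean (Ψ N) (fun n => if natAdd n 0 ∈ Ψ N then 0 else ‖f (natAdd n 0)‖ ^ 2) = 0 := by
        rw [mean, Finset.sum_eq_zero, zero_div]
        intro n hn
        exact if_pos hn
      rw [h0, add_zero]
    · refine le_trans ?_ (hWf2 N q)
      rcases hf' q with h | h <;> simp [h]
    · simp only [f', hq]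
      split_ifs <;> simp
  · have hlim : Tendsto (fun N : ℕ => 1 / ((N : ℝ) + 1) + (C / N + 1 / ((N : ℝ) + 1))) atTop
        (𝓝 0) := by
      have h1 := tendsto_one_div_add_atTop_nhds_zero_nat (𝕜 := ℝ)
      simpa using h1.add ((tendsto_const_div_atTop_nhds_zero_nat C).add h1)
    refine squeeze_zero' (Eventually.of_forall fun N => mean_nonneg fun _ _ => norm_nonneg _) ?_ hlim
    filter_upwards [hf, eventually_gt_atTop 0, eventually_ge_atTop m] with N hN hpos hm
    have hpos' : (0 : ℝ) < N := by exact_mod_cast hpos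
    have hn1 : ∀ q, 0 ≤ (N : ℝ)⁻¹ * ((Ψ N : Set ℕ+).indicator (fun q => ‖f q‖ ^ 2) q) := fun q =>
      mul_nonneg (by positivity) (Set.indicator_nonneg (fun _ _ => sq_nonneg _) _)
    have hn2 : ∀ q, 0 ≤ (N : ℝ) * (if q ∉ Ψ N then 1 else 0) := fun q => by
      split_ifs <;> positivity
    refine (mean_natAdd_le_of_stages hm (hj N) (hW N) (hΨ N)
      (G := fun q => ‖f' q - (truncation N f).1 q‖)
      -- Inside `Ψ N` the truncation error is at most $|f|^2/N$. Outside, `f'` vanishes and the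
      -- truncation is at most `N`, which `hbd` compensates by the rarity of such points.
      (V := fun q => (N : ℝ)⁻¹ * ((Ψ N : Set ℕ+).indicator (fun q => ‖f q‖ ^ 2) q)
        + N * (if q ∉ Ψ N then 1 else 0)) (fun q => add_nonneg (hn1 q) (hn2 q)) (fun q _ => ?_)
      (fun q hq => ?_)).trans ?_
    · refine le_trans ?_ (hWf N q)
      have h1 : ‖f' q‖ ≤ ‖f q‖ := by rcases hf' q with h | h <;> simp [h]
      have h2 := norm_truncation_le_norm N f q
      linarith [norm_sub_le (f' q) ((truncation N f).1 q)]
    · by_cases hmem : q ∈ Ψ N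
      · have e : f' q = f q := by simp only [f', hq, if_pos hmem]
        rw [e, Set.indicator_of_mem (Finset.mem_coe.2 hmem), if_neg (not_not.2 hmem), mul_zero,
          add_zero, ← div_eq_inv_mul, le_div_iff₀ hpos', mul_comm]
        exact mul_norm_sub_truncation_le N f q
      · have e : f' q = 0 := by simp only [f', hq, if_neg hmem]
        rw [e, zero_sub, norm_neg, if_pos hmem, mul_one]
        exact (norm_truncation_le N f q).trans (le_add_of_nonneg_left (hn1 q))
    · refine add_le_add_right ?_ _
      rw [mean_add, mean_const_mul, mean_const_mul]
      refine add_le_add ?_ ?_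
      · rw [div_eq_inv_mul]
        gcongr
        exact (mean_indicator_natAdd_le m fun q => sq_nonneg _).trans hN
      · refine le_of_eq_of_le ?_ (hbd N m hm)
        rw [mean, Finset.sum_boole]

end Decomposition

/-! ### The decomposition -/

theorem theorem3p16 (Φ : ℕ → Finset ℕ+) (hΦ : IsFolnerSeq Φ) (f : ℕ+ → ℂ) (hf : MemL2 Φ f) :
    ∃ (Ψ : ℕ → Finset ℕ+) (fc fwm : ℕ+ → ℂ),
      IsSubseq Ψ Φ ∧ MemL2 Ψ fc ∧ MemL2 Ψ fwm ∧
      IsCompactAlong Ψ fc ∧ IsWeakMixingAlong Ψ fwm ∧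
      besSeminorm Ψ (f - (fc + fwm)) = 0 ∧
      ((∀ m : ℕ+, MemL2 Φ (shift m f)) → f = fc + fwm) ∧
      (∀ a b : ℝ, a ≤ b → ValuesIn f a b → ValuesIn fc a b) := by
  classical
  obtain ⟨C, -, hC⟩ := hf.exists_eventually_le hΦ.nonempty
  let 𝒰 : Ultrafilter ℕ := hyperfilter ℕ
  have h𝒰 : (𝒰 : Filter ℕ) ≤ atTop := Nat.hyperfilter_le_atTop
  obtain ⟨H, _, _, _, ι, U, hd, hι, hU⟩ := exists_hilbert_of_bounded Φ hΦ 𝒰 h𝒰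
  obtain ⟨x, hx⟩ := cauchySeq_tendsto_of_complete (cauchySeq_truncation hι h𝒰 hC)
  have : CompleteSpace (compactVectors U) := (isClosed_compactVectors U).completeSpace_coe
  let z : H := (compactVectors U).starProjection x
  have hz : z ∈ compactVectors U := Submodule.starProjection_apply_mem _ x
  have hperp : x - z ∈ (compactVectors U)ᗮ := Submodule.sub_starProjection_mem_orthogonal x
  obtain ⟨u, hu, huv⟩ := exists_approx_projection hd hι hU hx hz hperp
  let g : ℕ → boundedFunctions := fun N => truncation N f - u N
  have hg : Tendsto (fun N => ι (g N)) atTop (𝓝 (x - z)) := by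
    simp only [g, map_sub]
    exact hx.sub hu
  -- Dominates every error an earlier stage can cause, in first and second power: `u i` in place of
  -- `u N`, and a modified `f` in place of `f` or its truncation.
  let W : ℕ → ℕ+ → ℝ := fun N q =>
    ∑ i ∈ Finset.range (N + 1), (‖(u i).1 q - (u N).1 q‖ + ‖(u i).1 q - (u N).1 q‖ ^ 2)
      + (2 * ‖f q‖ + ‖f q‖ ^ 2)
  have hWf : ∀ N q, 2 * ‖f q‖ + ‖f q‖ ^ 2 ≤ W N q := fun N q =>
    le_add_of_nonneg_left (Finset.sum_nonneg fun i _ => by positivity)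
  have hWu : ∀ N q i, i ≤ N → ‖(u i).1 q - (u N).1 q‖ + ‖(u i).1 q - (u N).1 q‖ ^ 2 ≤ W N q :=
    fun N q i hi => (Finset.single_le_sum
      (f := fun i => ‖(u i).1 q - (u N).1 q‖ + ‖(u i).1 q - (u N).1 q‖ ^ 2)
      (fun i _ => by positivity) (Finset.mem_range.2 (Nat.lt_succ_of_le hi))).trans
        (le_add_of_nonneg_right (by positivity))
  have hP : ∀ N : ℕ, ∀ᶠ k in 𝒰, CorrelationsClose ι U N (Φ k) (u N) ∧
      CorrelationsClose ι U N (Φ k) (g N) ∧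
      ∀ m ≤ N, N * ((((Φ k).filter fun n => natAdd n m ∉ Φ k).card : ℝ) / (Φ k).card)
        ≤ 1 / (N + 1) := fun N =>
    (eventually_correlationsClose hι hU N (u N)).and
      ((eventually_correlationsClose hι hU N (g N)).and
        ((eventually_all_finite (Set.finite_Iic N)).2 fun m _ => by
          have h := (hΦ.tendsto_card_filter m).const_mul (N : ℝ)
          rw [mul_zero] at h
          exact ((h.eventually_le_const (by positivity)).filter_mono h𝒰)))
  obtain ⟨φ, j, hφ, hPφ, hj, hWφ⟩ := exists_subsequence_stages hΦ h𝒰 hP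
    (W := W) (fun N q => le_trans (by positivity) (hWf N q))
  let Ψ : ℕ → Finset ℕ+ := Φ ∘ φ
  have hΨ : IsFolnerSeq Ψ := hΦ.comp hφ
  let fc : ℕ+ → ℂ := fun q => (u (j q)).1 q
  -- Used with $r(t)=t^2$ for compactness and with $r(t)=t$ for weak mixing.
  have happrox : ∀ (r : ℝ → ℝ), r 0 = 0 → (∀ t, 0 ≤ t → 0 ≤ r t) → (∀ t, 0 ≤ t → r t ≤ t + t ^ 2) →
      ∀ m, Tendsto (fun N => mean (Ψ N) fun p => r ‖natShift m fc p - natShift m (u N).1 p‖)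
        atTop (𝓝 0) := fun r hr0 hrn hr m => by
    refine squeeze_zero' (Eventually.of_forall fun N => mean_nonneg fun _ _ =>
      hrn _ (norm_nonneg _)) ?_ (tendsto_one_div_add_atTop_nhds_zero_nat (𝕜 := ℝ))
    filter_upwards [eventually_ge_atTop m] with N hm
    have h := mean_natAdd_le_of_stages hm (hj N) (hWφ N) (hΨ.nonempty N)
      (G := fun q => r ‖fc q - (u N).1 q‖) (V := fun _ => 0) (fun _ => le_rfl)
      (fun q hq => (hr _ (norm_nonneg _)).trans (hWu N q (j q) hq.le))
      (fun q hq => by simp only [fc, hq, sub_self, norm_zero, hr0, le_refl])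
    refine h.trans_eq ?_
    simp [mean]
  have hF2 := happrox (fun t => t ^ 2) (by norm_num) (fun t _ => sq_nonneg t)
    (fun t ht => le_add_of_nonneg_left ht)
  have hF1 := happrox (fun t => t) rfl (fun t ht => ht) (fun t _ => le_add_of_nonneg_right
    (sq_nonneg t))
  have hCΨ : ∀ᶠ N in atTop, mean (Ψ N) (fun n => ‖f n‖ ^ 2) ≤ C := hφ.tendsto_atTop.eventually hC
  obtain ⟨f', hf'0, hf'1, hf'2⟩ : ∃ f' : ℕ+ → ℂ,
      Tendsto (fun N => mean (Ψ N) fun n => ‖f n - f' n‖ ^ 2) atTop (𝓝 0) ∧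
      (∀ m : ℕ+, Tendsto (fun N => mean (Ψ N) fun p =>
        ‖natShift m f' p - natShift m (truncation N f).1 p‖) atTop (𝓝 0)) ∧
      ((∀ m : ℕ+, MemL2 Φ (shift m f)) → f' = f) := by
    -- If all shifts are in $L^2$, then `f` itself is kept, which gives the pointwise identity;
    -- otherwise null changes are allowed.
    by_cases hgood : ∀ m : ℕ+, MemL2 Φ (shift m f)
    · refine ⟨f, by simp [mean], fun m => ?_, fun _ => rfl⟩
      obtain ⟨D, -, hD⟩ := (hgood m).exists_eventually_le hΦ.nonempty
      exact tendsto_mean_norm_sub_truncation (hφ.tendsto_atTop.eventually hD)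
    · obtain ⟨f', h1, h2⟩ := exists_regular_modification hΨ.nonempty hj hWφ
        (fun N => (hPφ N).2.2) (fun N q => (le_add_of_nonneg_right (sq_nonneg _)).trans (hWf N q))
        (fun N q => (le_add_of_nonneg_left (by positivity)).trans (hWf N q)) hCΨ
      exact ⟨f', h1, fun m => h2 m, fun h => absurd h hgood⟩
  have hcL2 := eventually_mean_sq_norm_le hu (fun N => (hPφ N).1) (hF2 0)
  refine ⟨Ψ, fc, f' - fc, ⟨φ, hφ, rfl⟩, ?_, ?_, ?_, ?_, ?_, ?_, ?_⟩
  · obtain ⟨D, hD⟩ := hcL2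
    exact memL2_of_eventually_le hΨ.nonempty hD
  · obtain ⟨D, hD⟩ := hcL2
    -- Here `2 * C + 2 * 1` bounds the mean square of `f' = f - (f - f')`, the difference eventually
    -- having mean square at most 1.
    refine memL2_of_eventually_le hΨ.nonempty (C := 2 * (2 * C + 2 * 1) + 2 * D) ?_
    filter_upwards [hD, hCΨ, hf'0.eventually_le_const one_pos] with N h1 h2 h3
    refine (mean_sq_norm_sub_le (Ψ N) f' fc).trans ?_
    refine add_le_add (mul_le_mul_of_nonneg_left ?_ zero_le_two)
      (mul_le_mul_of_nonneg_left h1 zero_le_two)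
    have h4 := mean_sq_norm_sub_le (Ψ N) f (fun n => f n - f' n)
    simp only [sub_sub_cancel] at h4
    exact h4.trans (by gcongr)
  · exact isCompactAlong_of_approx hΨ.nonempty hz hu (fun N => (hPφ N).1) hF2
  · refine isWeakMixingAlong_of_approx hΨ hperp hg (fun N => (hPφ N).2.1) fun m => ?_
    have h := (hf'1 m).add (hF1 m)
    rw [add_zero] at h
    refine squeeze_zero (fun N => mean_nonneg fun _ _ => norm_nonneg _) (fun N => ?_) h
    rw [← mean_add]
    refine mean_mono fun p _ => ?_
    have e : natShift m (f' - fc) p - natShift m (g N).1 p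
        = (natShift m f' p - natShift m (truncation N f).1 p)
          - (natShift m fc p - natShift m (u N).1 p) := by
      simp only [natShift, g, Pi.sub_apply, Submodule.coe_sub]
      ring
    rw [e]
    exact norm_sub_le _ _
  · refine besSeminorm_eq_zero hΨ.nonempty (hf'0.congr fun N => ?_)
    simp only [add_sub_cancel, Pi.sub_apply]
  · intro hgood
    rw [add_sub_cancel, hf'2 hgood]
  · exact fun a b _ hab q => huv a b hab (j q) q
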